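/- Let $1\le d<M$ be integers, $Q=[0,2\pi)^M$, $Y'=[-\tfrac12,\tfrac12)^d$. Let $\Lambda$ be a real $M\times d$ matrix with $\Lambda^Tp\neq0$ for every nonzero $p\in\mathbb Z^M$, and let $B:\mathbb R^M\to\mathbb R^{d\times d}$ be smooth and $Q$-periodic (of period $2\pi$ in each coordinate) and such that the quasiperiodic matrix $A(x)=B(\Lambda x)$, $x\in\mathbb R^d$, is symmetric and coercive: for some $\alpha>0$, $\langle A(x)v,v\rangle\ge\alpha|v|^2$ for all $v\in\mathbb R^d$ and a.e. $x$. Fix $0<\delta<1$ and put $D=\Lambda^T\nabla_y$. For $\eta\in Y'$, a regularized Bloch eigenvalue is a $\lambda\in\mathbb R$ for which there is a nonzero $\phi$ in the space $H^1_\sharp(Q)$ of $Q$-periodic $H^1$ functions with $$-(D+i\eta)\cdot B(D+i\eta)\phi-\delta\Delta\phi=\lambda\phi$$ in the weak sense, i.e. for all $v\in H^1_\sharp(Q)$, $$\int_Q B(D+i\eta)\phi\cdot\overline{(D+i\eta)v}\,dy+\delta\int_Q\nabla\phi\cdot\overline{\nabla v}\,dy=\lambda\int_Q\phi\,\overline v\,dy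 .$$ The first one, $\lambda_1^\delta(\eta)$, is the smallest. A *ground state branch* consists of a ball $U^\delta=\{|\eta|<\theta\}\subseteq Y'$, $\theta>0$, on which $\lambda_1^\delta(\eta)$ exists and is real-analytic, together with eigenfunctions $\phi_1^\delta(\cdot;\eta)$ for $\lambda_1^\delta(\eta)$, $\eta\in U^\delta$, which are smooth and $Q$-periodic in $y$, such that $\eta\mapsto\phi_1^\delta(\cdot;\eta)\in H^1_\sharp(Q)$ is real-analytic on $U^\delta$ and $\phi_1^\delta(y;0)=(2\pi)^{-d/2}$ for all $y$. **Theorem.** A ground state branch exists, and for every ground state branch the following holds. Let $K\subseteq\mathbb R^d$ be compact, let $\epsilon$ run through a sequence of positive numbers tending to $0$, and let $g^\epsilon\in L^2(\mathbb R^d)$ (complex-valued) vanish a.e. outside $K$ and converge weakly in $L^2(\mathbb R^d)$ to some $g\in L^2(\mathbb R^d)$. For $\xi\in\epsilon^{-1}U^\delta$ let $$\mathcal B_1^{\delta,\epsilon}g^\epsilon(\xi)=\int_{\mathbb R^d}g^\epsilon(x)\,e^{-ix\cdot\xi}\,\overline{\phi_1^\delta\!\left(\tfrac{\Lambda x}{\epsilon};\epsilon\xi\right)}\,dx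 .$$ Then $$\chi_{\epsilon^{-1}U^\delta}\,\mathcal B_1^{\delta,\epsilon}g^\epsilon\rightharpoonup\widehat g\quad\text{weakly in }L^2_{\mathrm{loc}}(\mathbb R^d_\xi),\qquad \widehat g(\xi)=(2\pi)^{-d/2}\int_{\mathbb R^d}g(x)e^{-ix\cdot\xi}\,dx,$$ where the left-hand side is extended by zero outside $\epsilon^{-1}U^\delta$; that is, for every compact $K_2\subset\mathbb R^d$, $\widehat g$ and, for all sufficiently small $\epsilon$ in the sequence, $\chi_{\epsilon^{-1}U^\delta}\mathcal B_1^{\delta,\epsilon}g^\epsilon$ belong to $L^2(K_2)$, and the latter converge weakly to $\widehat g$ in $L^2(K_2)$. -/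

import Mathlib

open MeasureTheory Filter Topology
open scoped ContDiff ComplexConjugate Matrix

namespace QuasiBloch

noncomputable section

/-- `ℝⁿ` with its Euclidean norm. -/
abbrev E (n : ℕ) : Type := EuclideanSpace ℝ (Fin n)

/-! ### Quasiperiodic coefficients -/

/-- The point `Λ x ∈ ℝᴹ` for `x ∈ ℝᵈ` and an `M × d` matrix `Λ`. -/
def wind {M d : ℕ} (Λ : Matrix (Fin M) (Fin d) ℝ) (x : E d) : E M :=
  WithLp.toLp 2 (Λ *ᵥ x.ofLp)

/-- `Q`-periodicity, `Q = [0, 2π)ᴹ`: period `2π` in each coordinate of `ℝᴹ`. -/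
def QPeriodic {M : ℕ} {α : Type*} (f : E M → α) : Prop :=
  ∀ (i : Fin M) (y : E M), f (y + EuclideanSpace.single i (2 * Real.pi)) = f y

/-- The standing assumptions on the quasiperiodic coefficient matrix `A(x) = B(Λ x)` on `ℝᵈ`:
`B` is real, smooth and `Q`-periodic on `ℝᴹ`, `Λᵀ p ≠ 0` for nonzero integer vectors `p`, and `A` is
symmetric and coercive. (Smoothness and boundedness of `A` follow.) -/
structure IsQuasiperiodicCoeff {M d : ℕ} (Λ : Matrix (Fin M) (Fin d) ℝ)
    (B : E M → Matrix (Fin d) (Fin d) ℝ) : Prop where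
  smooth : ∀ k l, ContDiff ℝ ∞ (fun y => B y k l)
  periodic : QPeriodic B
  irrational : ∀ p : Fin M → ℤ, p ≠ 0 → Λᵀ *ᵥ (fun i => (p i : ℝ)) ≠ 0
  symm : ∀ x : E d, (B (wind Λ x)).IsSymm
  coercive : ∃ α : ℝ, 0 < α ∧ ∀ᵐ x : E d, ∀ v : E d,
    α * ‖v‖ ^ 2 ≤ ∑ k, ∑ l, B (wind Λ x) k l * v l * v k

/-! ### The periodic Sobolev space `H¹_♯(Q)` -/

/-- The cell `Q = [0, 2π)ᴹ`. -/
def cellQ (M : ℕ) : Set (E M) := {y | ∀ i, y i ∈ Set.Ico 0 (2 * Real.pi)}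

/-- Lebesgue measure on `Q`. -/
abbrev volQ (M : ℕ) : Measure (E M) := volume.restrict (cellQ M)

/-- `L²_♯(Q)`, with complex values. -/
abbrev L2Q (M : ℕ) : Type := Lp ℂ 2 (volQ M)

/-- `∂ψ/∂y_m`. -/
def partialDeriv {M : ℕ} (m : Fin M) (ψ : E M → ℂ) (y : E M) : ℂ :=
  fderiv ℝ ψ y (EuclideanSpace.single m 1)

/-- `G ∈ L²(Q)` is the weak derivative `∂u/∂y_m` of the periodic function `u ∈ L²(Q)`, tested
against all smooth `Q`-periodic functions. -/
def HasWeakPartial {M : ℕ} (m : Fin M) (u G : L2Q M) : Prop :=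
  ∀ ψ : E M → ℂ, ContDiff ℝ ∞ ψ → QPeriodic ψ →
    ∫ y, u y * partialDeriv m ψ y ∂(volQ M) = - ∫ y, G y * ψ y ∂(volQ M)

theorem cellQ_subset (M : ℕ) :
    cellQ M ⊆ WithLp.ofLp ⁻¹' (Set.Icc (0 : Fin M → ℝ) (fun _ => 2 * Real.pi)) :=
  fun _ hy => ⟨fun i => (hy i).1, fun i => (hy i).2.le⟩

theorem isCompact_box (M : ℕ) :
    IsCompact ((WithLp.ofLp : E M → Fin M → ℝ) ⁻¹' (Set.Icc 0 (fun _ => 2 * Real.pi))) :=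
  (PiLp.homeomorph 2 (fun _ : Fin M => ℝ)).isCompact_preimage.2 isCompact_Icc

theorem integrable_mul_test {M : ℕ} (u : L2Q M) {ψ : E M → ℂ} (hψ : Continuous ψ) :
    Integrable (fun y => u y * ψ y) (volQ M) := by
  have hb : IntegrableOn (fun y => ‖ψ y‖ ^ 2) (cellQ M) :=
    ((hψ.norm.pow 2).continuousOn.integrableOn_compact (isCompact_box M)).mono_set
      (cellQ_subset M)
  have h2 : MemLp ψ 2 (volQ M) :=
    (memLp_two_iff_integrable_sq_norm hψ.aestronglyMeasurable).2 hb
  exact (Lp.memLp u).integrable_mul h2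

theorem continuous_partialDeriv {M : ℕ} (m : Fin M) {ψ : E M → ℂ} (hψ : ContDiff ℝ ∞ ψ) :
    Continuous (partialDeriv m ψ) :=
  (hψ.continuous_fderiv (by simp)).clm_apply continuous_const

theorem HasWeakPartial.zero {M : ℕ} (m : Fin M) : HasWeakPartial m (0 : L2Q M) 0 := by
  intro ψ _ _
  have h : ∀ χ : E M → ℂ, ∫ y, (0 : L2Q M) y * χ y ∂(volQ M) = 0 := fun χ => by
    rw [integral_congr_ae (g := fun _ => (0 : ℂ)), integral_zero]
    filter_upwards [Lp.coeFn_zero ℂ 2 (volQ M)] with y hy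
    rw [hy, Pi.zero_apply, zero_mul]
  rw [h, h, neg_zero]

theorem HasWeakPartial.add {M : ℕ} {m : Fin M} {u v G H : L2Q M}
    (hu : HasWeakPartial m u G) (hv : HasWeakPartial m v H) :
    HasWeakPartial m (u + v) (G + H) := by
  intro ψ hs hp
  have h : ∀ (a b : L2Q M) (χ : E M → ℂ), Continuous χ →
      ∫ y, (a + b : L2Q M) y * χ y ∂(volQ M)
        = ∫ y, a y * χ y ∂(volQ M) + ∫ y, b y * χ y ∂(volQ M) := fun a b χ hχ => by
    rw [← integral_add (integrable_mul_test a hχ) (integrable_mul_test b hχ)]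
    refine integral_congr_ae ?_
    filter_upwards [Lp.coeFn_add a b] with y hy
    rw [hy, Pi.add_apply, add_mul]
  rw [h _ _ _ (continuous_partialDeriv m hs), h _ _ _ hs.continuous, hu ψ hs hp, hv ψ hs hp,
    neg_add]

theorem HasWeakPartial.smul {M : ℕ} {m : Fin M} {u G : L2Q M} (c : ℂ)
    (hu : HasWeakPartial m u G) : HasWeakPartial m (c • u) (c • G) := by
  intro ψ hs hp
  have h : ∀ (a : L2Q M) (χ : E M → ℂ),
      ∫ y, (c • a : L2Q M) y * χ y ∂(volQ M) = c * ∫ y, a y * χ y ∂(volQ M) := fun a χ => by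
    rw [← integral_const_mul]
    refine integral_congr_ae ?_
    filter_upwards [Lp.coeFn_smul c a] with y hy
    rw [hy, Pi.smul_apply, smul_eq_mul, mul_assoc]
  rw [h, h, hu ψ hs hp, mul_neg]

/-- `H¹_♯(Q)`: the pairs `(u, ∇u)` of an `L²` function and its weak gradient, with the norm
`(‖u‖² + ∑ₘ ‖∂ₘu‖²)^{1/2}`. -/
def H1 (M : ℕ) : Submodule ℂ (WithLp 2 (L2Q M × PiLp 2 (fun _ : Fin M => L2Q M))) where
  carrier := {p | ∀ m, HasWeakPartial m p.fst (p.snd m)}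
  zero_mem' := fun m => HasWeakPartial.zero m
  add_mem' := fun hp hq m => (hp m).add (hq m)
  smul_mem' := fun c _ hp m => (hp m).smul c

/-- The function underlying an element of `H¹_♯(Q)`. -/
def h1Fn {M : ℕ} (u : H1 M) : L2Q M := u.1.fst

/-- `∂u/∂y_m` for `u ∈ H¹_♯(Q)`. -/
def h1Grad {M : ℕ} (u : H1 M) (m : Fin M) : L2Q M := u.1.snd m

/-! ### Regularized Bloch waves -/

/-- The `l`-th component of `(D + iη)u`, where `D = Λᵀ∇`. -/
def shiftedGrad {M d : ℕ} (Λ : Matrix (Fin M) (Fin d) ℝ) (η : E d) (u : H1 M) (l : Fin d)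
    (y : E M) : ℂ :=
  ∑ m, (Λ m l : ℂ) * h1Grad u m y + Complex.I * (η l : ℂ) * h1Fn u y

/-- The form of `-(D + iη)·B(D + iη) - δΔ` on `H¹_♯(Q)`:
`∫_Q B (D + iη)u · conj((D + iη)v) dy + δ ∫_Q ∇u · conj(∇v) dy`. -/
def blochForm {M d : ℕ} (Λ : Matrix (Fin M) (Fin d) ℝ) (B : E M → Matrix (Fin d) (Fin d) ℝ)
    (δ : ℝ) (η : E d) (u v : H1 M) : ℂ :=
  ∫ y, ∑ k, ∑ l, (B y k l : ℂ) * shiftedGrad Λ η u l y * conj (shiftedGrad Λ η v k y) ∂(volQ M)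
    + (δ : ℂ) * ∫ y, ∑ m, h1Grad u m y * conj (h1Grad v m y) ∂(volQ M)

/-- `u` is a regularized Bloch wave at quasimomentum `η` with eigenvalue `μ`: a nonzero
`u ∈ H¹_♯(Q)` with `-(D + iη)·B(D + iη)u - δΔu = μ u` weakly. -/
def IsBlochWave {M d : ℕ} (Λ : Matrix (Fin M) (Fin d) ℝ) (B : E M → Matrix (Fin d) (Fin d) ℝ)
    (δ : ℝ) (η : E d) (μ : ℝ) (u : H1 M) : Prop :=
  u ≠ 0 ∧ ∀ v : H1 M,
    blochForm Λ B δ η u v = (μ : ℂ) * ∫ y, h1Fn u y * conj (h1Fn v y) ∂(volQ M)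

/-- The set of regularized Bloch eigenvalues at `η`; the first one is its least element. -/
def blochEigenvalues {M d : ℕ} (Λ : Matrix (Fin M) (Fin d) ℝ)
    (B : E M → Matrix (Fin d) (Fin d) ℝ) (δ : ℝ) (η : E d) : Set ℝ :=
  {μ | ∃ u : H1 M, IsBlochWave Λ B δ η μ u}

/-- `Y' = [-1/2, 1/2)ᵈ`. -/
def dualCell (d : ℕ) : Set (E d) := {η | ∀ j, η j ∈ Set.Ico (-1 / 2 : ℝ) (1 / 2)}

/-- `lam` and `φ` are the first regularized Bloch eigenvalue `λ₁^δ(η)` and an analytic choice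
`φ₁^δ(y; η)` of the first regularized Bloch eigenfunction on the ball `U^δ = {|η| < θ} ⊆ Y'`,
normalized by `φ₁^δ(y; 0) = (2π)^{-d/2}`. Here `φ η` is the smooth `Q`-periodic representative of
the element `Φ η` of `H¹_♯(Q)`. -/
structure IsGroundState {M d : ℕ} (Λ : Matrix (Fin M) (Fin d) ℝ)
    (B : E M → Matrix (Fin d) (Fin d) ℝ) (δ θ : ℝ) (lam : E d → ℝ) (Φ : E d → H1 M)
    (φ : E d → E M → ℂ) : Prop where
  radius_pos : 0 < θ
  ball_subset : Metric.ball (0 : E d) θ ⊆ dualCell d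
  isLeast : ∀ η ∈ Metric.ball (0 : E d) θ, IsLeast (blochEigenvalues Λ B δ η) (lam η)
  analytic_eigenvalue : AnalyticOnNhd ℝ lam (Metric.ball (0 : E d) θ)
  isBlochWave : ∀ η ∈ Metric.ball (0 : E d) θ, IsBlochWave Λ B δ η (lam η) (Φ η)
  analytic_eigenfunction : AnalyticOnNhd ℝ Φ (Metric.ball (0 : E d) θ)
  smooth : ∀ η ∈ Metric.ball (0 : E d) θ, ContDiff ℝ ∞ (φ η)
  periodic : ∀ η ∈ Metric.ball (0 : E d) θ, QPeriodic (φ η)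
  represents : ∀ η ∈ Metric.ball (0 : E d) θ, h1Fn (Φ η) =ᵐ[volQ M] φ η
  normalized : ∀ y, φ 0 y = (((2 * Real.pi) ^ (-(d : ℝ) / 2) : ℝ) : ℂ)

/-! ### Bloch coefficient, Fourier transform, weak convergence -/

/-- `B₁^{δ,ε} g(ξ) = ∫ g(x) e^{-i x·ξ} conj(φ(Λx/ε; εξ)) dx`. -/
def blochCoeff {M d : ℕ} (Λ : Matrix (Fin M) (Fin d) ℝ) (φ : E d → E M → ℂ) (ε : ℝ)
    (g : E d → ℂ) (ξ : E d) : ℂ :=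
  ∫ x, g x * Complex.exp (-Complex.I * (inner ℝ x ξ : ℝ)) * conj (φ (ε • ξ) (ε⁻¹ • wind Λ x))

/-- The unitary Fourier transform `ĝ(ξ) = (2π)^{-d/2} ∫ g(x) e^{-i x·ξ} dx` of an integrable `g`. -/
def fourierHat {d : ℕ} (g : E d → ℂ) (ξ : E d) : ℂ :=
  (((2 * Real.pi) ^ (-(d : ℝ) / 2) : ℝ) : ℂ) *
    ∫ x, g x * Complex.exp (-Complex.I * (inner ℝ x ξ : ℝ))

/-- `f n ⇀ f₀` weakly in `L²_loc(ℝᵈ)`: on each compact set `K` the functions are in `L²(K)` (for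
all large `n`) and converge weakly in `L²(K)`. -/
def TendstoWeakL2Loc {d : ℕ} (f : ℕ → E d → ℂ) (f₀ : E d → ℂ) : Prop :=
  ∀ K : Set (E d), IsCompact K →
    MemLp f₀ 2 (volume.restrict K) ∧
    (∀ᶠ n in atTop, MemLp (f n) 2 (volume.restrict K)) ∧
    ∀ ψ : E d → ℂ, MemLp ψ 2 (volume.restrict K) →
      Tendsto (fun n => ∫ ξ in K, f n ξ * conj (ψ ξ)) atTop (𝓝 (∫ ξ in K, f₀ ξ * conj (ψ ξ)))

/-- `g n ⇀ g₀` weakly in `L²(ℝᵈ)`. -/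
def TendstoWeakL2 {d : ℕ} (g : ℕ → Lp ℂ 2 (volume : Measure (E d)))
    (g₀ : Lp ℂ 2 (volume : Measure (E d))) : Prop :=
  ∀ h : Lp ℂ 2 (volume : Measure (E d)),
    Tendsto (fun n => inner ℂ h (g n)) atTop (𝓝 (inner ℂ h g₀))

end

end QuasiBloch

namespace QuasiBloch

noncomputable section

/-! ### The cell as a model of the torus -/

/-! Everything rests on reducing the eigenvalue problem near the bottom of the spectrum to one
scalar equation. On `H¹_♯(Q)` the form is represented by a bounded symmetric operator `opA`, and
`-δΔ` with the Poincaré inequality controls everything except the constants. Adding to `opA - λ` the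
rank-one form of the mean value gives `opP`, which is coercive for `λ < δ/2`, hence invertible. With
`sol` the solution of `opP u = meanVec`, an eigenvector with eigenvalue `λ < δ/2` is its zeroth
Fourier coefficient times `sol`, and `sol` is itself an eigenvector as soon as its zeroth
coefficient equals 1.

Existence: at `η = 0` that coefficient is `1/(1 - λ)`, with `λ`-derivative 1 at `λ = 0`, so the
analytic implicit function theorem produces `λ(η)` and `sol` produces the eigenfunction. It stays
close to a constant; an eigenvector for a smaller eigenvalue would be orthogonal to it, hence have
small mean and, by Poincaré, too much energy (`le_of_eigen`).

Regularity in `y`: translating an eigenfunction by `s` solves the problem with translated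
coefficients, so the translate is a fixed multiple of `sol` for those coefficients, which is smooth
in `s`. Differentiating in `s` gives decay of the Fourier coefficients of every order, with
constants controlled continuously in `(η, λ)` (`exists_coef_eq`). Thus any ground state branch is,
near `η = 0`, continuous in `η` uniformly in `y`.

Convergence: the `g^ε` are bounded in `L¹`, being supported in `K` and weakly convergent. Replacing
the Bloch amplitude at `εξ` by the constant one at 0 therefore costs `o(1)`, and what remains is the
Fourier transform of `g^ε`, which converges pointwise. Dominated convergence finishes.

The hypotheses on `A(x) = B(Λx)` are carried to all of `Q` by density of the winding `Λx` in the
torus (`denseRange_proj_wind`). -/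

/-- The covering map `ℝᴹ → (ℝ/ℤ)ᴹ`, `y ↦ y / 2π`. -/
def proj {M : ℕ} (y : E M) : UnitAddTorus (Fin M) :=
  fun i => ((y i / (2 * Real.pi) : ℝ) : UnitAddCircle)

/-- The section of `proj` with values in `(0, 2π]ᴹ`. -/
def lift {M : ℕ} (t : UnitAddTorus (Fin M)) : E M :=
  WithLp.toLp 2 fun i => 2 * Real.pi * (AddCircle.equivIoc (1 : ℝ) 0 (t i) : ℝ)

/-- Haar probability measure on the torus. -/
abbrev haarT (M : ℕ) : Measure (UnitAddTorus (Fin M)) :=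
  Measure.pi fun _ => AddCircle.haarAddCircle

theorem proj_lift {M : ℕ} (t : UnitAddTorus (Fin M)) : proj (lift t) = t := by
  funext i
  have h : 2 * Real.pi * (AddCircle.equivIoc (1 : ℝ) 0 (t i) : ℝ) / (2 * Real.pi)
      = (AddCircle.equivIoc (1 : ℝ) 0 (t i) : ℝ) := by
    field_simp
  simp only [proj, lift, h, AddCircle.coe_equivIoc]

theorem measurable_lift {M : ℕ} : Measurable (lift : UnitAddTorus (Fin M) → E M) := by
  refine (PiLp.volume_preserving_toLp (Fin M)).measurable.comp (measurable_pi_lambda _ fun i => ?_)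
  exact ((measurable_subtype_coe.comp (AddCircle.measurableEquivIoc (1 : ℝ) 0).measurable).comp
    (measurable_pi_apply i)).const_mul _

theorem proj_add {M : ℕ} (y z : E M) : proj (y + z) = proj y + proj z := by
  funext i
  simp [proj, add_div]

theorem measurePreserving_proj_one :
    MeasurePreserving (fun x : ℝ => ((x / (2 * Real.pi) : ℝ) : UnitAddCircle))
      (volume.restrict (Set.Ioc 0 (2 * Real.pi)))
      (ENNReal.ofReal (2 * Real.pi) • AddCircle.haarAddCircle) := by
  have hpi : (0 : ℝ) < 2 * Real.pi := by positivity
  have h1 : MeasurePreserving (fun x : ℝ => x / (2 * Real.pi))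
      (volume.restrict (Set.Ioc 0 (2 * Real.pi)))
      (ENNReal.ofReal (2 * Real.pi) • volume.restrict (Set.Ioc 0 1)) := by
    have hv : MeasurePreserving (fun x : ℝ => x / (2 * Real.pi)) volume
        (ENNReal.ofReal (2 * Real.pi) • volume) := by
      refine ⟨by fun_prop, ?_⟩
      have := Real.map_volume_mul_left (inv_ne_zero hpi.ne')
      rw [inv_inv, abs_of_pos hpi] at this
      rw [← this]
      congr 1
      funext x
      field_simp
    have := hv.restrict_preimage (s := Set.Ioc 0 1) measurableSet_Ioc
    rw [Measure.restrict_smul] at this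
    convert this using 2
    ext x
    simp only [Set.mem_Ioc, Set.mem_preimage, div_pos_iff_of_pos_right hpi, div_le_one hpi]
  have h2 := UnitAddCircle.measurePreserving_mk 0
  rw [zero_add] at h2
  have h3 : MeasurePreserving (fun x : ℝ => (x : UnitAddCircle))
      (ENNReal.ofReal (2 * Real.pi) • volume.restrict (Set.Ioc 0 1))
      (ENNReal.ofReal (2 * Real.pi) • volume) := h2.smul_measure _
  rw [AddCircle.volume_eq_smul_haarAddCircle, ENNReal.ofReal_one, one_smul] at h3
  exact h3.comp h1

theorem volQ_eq (M : ℕ) : volQ M = volume.restrict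
    (WithLp.ofLp ⁻¹' (Set.univ.pi fun _ : Fin M => Set.Ico 0 (2 * Real.pi))) := by
  have : cellQ M = WithLp.ofLp ⁻¹' (Set.univ.pi fun _ : Fin M => Set.Ico 0 (2 * Real.pi)) := by
    ext y; simp [cellQ]
  rw [volQ, this]

theorem measurePreserving_ofLp_volQ (M : ℕ) :
    MeasurePreserving (WithLp.ofLp : E M → Fin M → ℝ) (volQ M)
      (Measure.pi fun _ => volume.restrict (Set.Ioc 0 (2 * Real.pi))) := by
  have h := (PiLp.volume_preserving_ofLp (Fin M)).restrict_preimage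
    (s := Set.univ.pi fun _ : Fin M => Set.Ico 0 (2 * Real.pi))
    (MeasurableSet.univ_pi fun _ => measurableSet_Ico)
  rw [volQ_eq]
  convert h using 1
  rw [volume_pi, Measure.restrict_pi_pi]
  congr 1
  funext i
  exact Measure.restrict_congr_set (Ico_ae_eq_Ioc (μ := volume)).symm

instance isFiniteMeasure_smul_haar : IsFiniteMeasure
    (ENNReal.ofReal (2 * Real.pi) • AddCircle.haarAddCircle (T := 1)) :=
  Measure.smul_finite _ ENNReal.ofReal_ne_top

theorem pi_smul_haar (M : ℕ) :
    Measure.pi (fun _ : Fin M => ENNReal.ofReal (2 * Real.pi) • AddCircle.haarAddCircle (T := 1))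
      = ENNReal.ofReal (2 * Real.pi) ^ M • haarT M := by
  refine Measure.pi_eq fun s _ => ?_
  simp [Measure.smul_apply, Measure.pi_pi, Finset.prod_mul_distrib]

theorem measurePreserving_proj (M : ℕ) :
    MeasurePreserving proj (volQ M) (ENNReal.ofReal (2 * Real.pi) ^ M • haarT M) := by
  rw [← pi_smul_haar]
  exact (measurePreserving_pi _ _ fun _ => measurePreserving_proj_one).comp
    (measurePreserving_ofLp_volQ M)

/-- Only almost everywhere: `lift` takes values in `(0, 2π]ᴹ`, while the cell is `[0, 2π)ᴹ`. -/
theorem lift_proj_ae (M : ℕ) : ∀ᵐ y ∂(volQ M), lift (proj y) = y := by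
  have h : ∀ᵐ z : Fin M → ℝ ∂(Measure.pi fun _ => volume.restrict (Set.Ioc 0 (2 * Real.pi))),
      ∀ i, z i ∈ Set.Ioc 0 (2 * Real.pi) := by
    rw [ae_all_iff]
    intro i
    exact (Measure.tendsto_eval_ae_ae (i := i)).eventually
      (ae_restrict_mem measurableSet_Ioc)
  filter_upwards [(measurePreserving_ofLp_volQ M).quasiMeasurePreserving.ae h] with y hy
  ext i
  have hpi : (0 : ℝ) < 2 * Real.pi := by positivity
  have hi : y i / (2 * Real.pi) ∈ Set.Ioc (0 : ℝ) (0 + 1) := by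
    have := hy i
    exact ⟨div_pos this.1 hpi, by rw [zero_add, div_le_one hpi]; exact this.2⟩
  simp only [lift, proj, AddCircle.equivIoc_coe_eq hi]
  field_simp

theorem measurePreserving_lift (M : ℕ) :
    MeasurePreserving lift (ENNReal.ofReal (2 * Real.pi) ^ M • haarT M) (volQ M) := by
  refine ⟨measurable_lift, ?_⟩
  rw [← (measurePreserving_proj M).map_eq,
    Measure.map_map measurable_lift (measurePreserving_proj M).measurable]
  rw [Measure.map_congr (show lift ∘ proj =ᵐ[volQ M] id from lift_proj_ae M), Measure.map_id]

instance isFiniteMeasure_volQ (M : ℕ) : IsFiniteMeasure (volQ M) := by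
  refine ⟨?_⟩
  have := (isCompact_box M).measure_lt_top (μ := volume)
  rw [Measure.restrict_apply_univ]
  exact (measure_mono (cellQ_subset M)).trans_lt this

theorem proj_eq_iff {M : ℕ} {y z : E M} : proj y = proj z ↔
    ∃ n : Fin M → ℤ, y = z + ∑ i, n i • EuclideanSpace.single i (2 * Real.pi) := by
  have hpi : (2 * Real.pi : ℝ) ≠ 0 := by positivity
  constructor
  · intro h
    have : ∀ i, ∃ n : ℤ, y i = z i + n * (2 * Real.pi) := by
      intro i
      have hi := congr_fun h i
      simp only [proj] at hi
      rw [eq_comm, QuotientAddGroup.eq_iff_sub_mem, AddSubgroup.mem_zmultiples_iff] at hi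
      obtain ⟨n, hn⟩ := hi
      refine ⟨-n, ?_⟩
      rw [zsmul_eq_mul, mul_one] at hn
      field_simp at hn
      push_cast
      linarith
    choose n hn using this
    refine ⟨n, ?_⟩
    ext i
    simp [hn i, Finset.sum_apply, Pi.single_apply]
  · rintro ⟨n, rfl⟩
    funext i
    simp [proj, add_div, Finset.sum_apply, Pi.single_apply, hpi]

theorem QPeriodic.add_sum {M : ℕ} {α : Type*} {f : E M → α} (hf : QPeriodic f) (n : Fin M → ℤ)
    (y : E M) : f (y + ∑ i, n i • EuclideanSpace.single i (2 * Real.pi)) = f y := by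
  have h : ∀ s : Finset (Fin M), ∀ y,
      f (y + ∑ i ∈ s, n i • EuclideanSpace.single i (2 * Real.pi)) = f y := by
    intro s
    induction s using Finset.induction_on with
    | empty => simp
    | insert i s hi ih =>
      intro y
      rw [Finset.sum_insert hi, ← add_assoc, ih]
      exact Function.Periodic.zsmul (f := f) (fun y => hf i y) (n i) y
  exact h _ y

theorem QPeriodic.eq_of_proj_eq {M : ℕ} {α : Type*} {f : E M → α} (hf : QPeriodic f) {y z : E M}
    (h : proj y = proj z) : f y = f z := by
  obtain ⟨n, rfl⟩ := proj_eq_iff.1 h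
  exact hf.add_sum n z

theorem QPeriodic.comp_lift_proj {M : ℕ} {α : Type*} {f : E M → α} (hf : QPeriodic f) (y : E M) :
    f (lift (proj y)) = f y :=
  hf.eq_of_proj_eq (proj_lift _)

/-- Translation by `s` in the `m`-th coordinate, modulo `2π`. -/
def shift {M : ℕ} (m : Fin M) (s : ℝ) (y : E M) : E M :=
  lift (proj (y + EuclideanSpace.single m s))

theorem QPeriodic.comp_shift {M : ℕ} {α : Type*} {f : E M → α} (hf : QPeriodic f) (m : Fin M)
    (s : ℝ) (y : E M) : f (shift m s y) = f (y + EuclideanSpace.single m s) :=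
  hf.comp_lift_proj _

/-- On the torus the shift is a group translation, and Haar measure is invariant. -/
theorem measurePreserving_shift {M : ℕ} (m : Fin M) (s : ℝ) :
    MeasurePreserving (shift m s) (volQ M) (volQ M) := by
  have h : MeasurePreserving (fun t => t + proj (EuclideanSpace.single m s)) (haarT M) (haarT M) :=
    measurePreserving_add_right _ _
  have h' := (measurePreserving_lift M).comp
    ((h.smul_measure (ENNReal.ofReal (2 * Real.pi) ^ M)).comp (measurePreserving_proj M))
  convert h' using 1
  funext y
  simp [shift, proj_add]

theorem shift_zero_ae {M : ℕ} (m : Fin M) : ∀ᵐ y ∂(volQ M), shift m 0 y = y := by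
  filter_upwards [lift_proj_ae M] with y hy
  have h0 : EuclideanSpace.single m (0 : ℝ) = 0 := by ext i; simp
  rw [shift, h0, add_zero, hy]

theorem shift_shift {M : ℕ} (m : Fin M) (s t : ℝ) (y : E M) :
    shift m s (shift m t y) = shift m (t + s) y := by
  have : EuclideanSpace.single m (t + s) = EuclideanSpace.single m t + EuclideanSpace.single m s := by
    ext i; by_cases h : i = m <;> simp [h]
  simp only [shift]
  rw [proj_add, proj_lift, ← proj_add, this, add_assoc]

/-! ### Fourier series on the cell -/

theorem integral_comp_of_measurePreserving {α β F : Type*} [MeasurableSpace α] [MeasurableSpace β]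
    [NormedAddCommGroup F] [NormedSpace ℝ F] {μ : Measure α} {ν : Measure β} {f : α → β}
    (hf : MeasurePreserving f μ ν) {g : β → F} (hg : AEStronglyMeasurable g ν) :
    ∫ x, g (f x) ∂μ = ∫ y, g y ∂ν := by
  rw [← hf.map_eq, integral_map hf.measurable.aemeasurable (by rwa [hf.map_eq])]

/-- The character `y ↦ e^{i k·y}`. -/
def char {M : ℕ} (k : Fin M → ℤ) (y : E M) : ℂ :=
  Complex.exp (((∑ j, (k j : ℝ) * y j : ℝ) : ℂ) * Complex.I)

theorem mFourier_proj {M : ℕ} (k : Fin M → ℤ) (y : E M) :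
    UnitAddTorus.mFourier k (proj y) = char k y := by
  have h : ∀ i, fourier (k i) (proj y i) = Complex.exp (((k i : ℝ) * y i : ℝ) * Complex.I) := by
    intro i
    rw [proj, fourier_coe_apply]
    congr 1
    have : (Real.pi : ℂ) ≠ 0 := by exact_mod_cast Real.pi_ne_zero
    push_cast
    field_simp
  simp only [UnitAddTorus.mFourier, ContinuousMap.coe_mk, h, char, ← Complex.exp_sum,
    ← Finset.sum_mul, ← Complex.ofReal_sum]

theorem contDiff_char {M : ℕ} (k : Fin M → ℤ) {n : WithTop ℕ∞} : ContDiff ℝ n (char k) := by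
  unfold char
  have h : ContDiff ℝ n fun y : E M => ∑ j, (k j : ℝ) * y j := by
    refine ContDiff.sum fun i _ => contDiff_const.mul ?_
    exact (EuclideanSpace.proj (𝕜 := ℝ) i).contDiff
  exact ((Complex.ofRealCLM.contDiff.comp h).mul contDiff_const).cexp

theorem norm_char {M : ℕ} (k : Fin M → ℤ) (y : E M) : ‖char k y‖ = 1 :=
  Complex.norm_exp_ofReal_mul_I _

theorem qPeriodic_comp_proj {M : ℕ} {α : Type*} (f : UnitAddTorus (Fin M) → α) :
    QPeriodic fun y => f (proj y) := by
  intro i y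
  have : proj (y + EuclideanSpace.single i (2 * Real.pi)) = proj y := by
    refine proj_eq_iff.2 ⟨Pi.single i 1, ?_⟩
    rw [Finset.sum_eq_single i] <;> simp +contextual
  simp only [this]

theorem qPeriodic_char {M : ℕ} (k : Fin M → ℤ) : QPeriodic (char k) := by
  have := qPeriodic_comp_proj (UnitAddTorus.mFourier k)
  simpa only [mFourier_proj] using this

theorem partialDeriv_char {M : ℕ} (k : Fin M → ℤ) (m : Fin M) (y : E M) :
    partialDeriv m (char k) y = Complex.I * (k m : ℂ) * char k y := by
  have h1 : HasFDerivAt (fun y : E M => (∑ j, (k j : ℝ) * y j : ℝ))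
      (∑ j, (k j : ℝ) • (EuclideanSpace.proj (𝕜 := ℝ) j : E M →L[ℝ] ℝ)) y := by
    refine HasFDerivAt.fun_sum fun i _ => ?_
    exact ((EuclideanSpace.proj (𝕜 := ℝ) i : E M →L[ℝ] ℝ).hasFDerivAt).const_mul _
  have h2 := (Complex.ofRealCLM.hasFDerivAt.comp y h1)
  have h3 := (h2.mul_const Complex.I).cexp
  have h4 : fderiv ℝ (char k) y = _ := h3.fderiv
  rw [partialDeriv, h4]
  simp [char]
  ring

theorem char_neg {M : ℕ} (k : Fin M → ℤ) (y : E M) : char (-k) y = conj (char k y) := by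
  rw [← mFourier_proj, ← mFourier_proj, UnitAddTorus.mFourier_neg]

theorem char_zero {M : ℕ} (y : E M) : char 0 y = 1 := by simp [char]

theorem char_add {M : ℕ} (k : Fin M → ℤ) (y z : E M) :
    char k (y + z) = char k y * char k z := by
  simp only [char, ← Complex.exp_add, ← add_mul, ← Complex.ofReal_add]
  congr 4
  simp [mul_add, Finset.sum_add_distrib]

/-- `(2π)^{-M/2}`. -/
def normC (M : ℕ) : ℝ := (2 * Real.pi) ^ (-(M : ℝ) / 2)

theorem normC_pos (M : ℕ) : 0 < normC M := Real.rpow_pos_of_pos (by positivity) _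

theorem normC_sq (M : ℕ) : normC M ^ 2 * (2 * Real.pi) ^ M = 1 := by
  have h : (0 : ℝ) < 2 * Real.pi := by positivity
  rw [normC, ← Real.rpow_natCast, ← Real.rpow_natCast, ← Real.rpow_mul h.le, ← Real.rpow_add h]
  convert Real.rpow_zero _ using 2
  push_cast; ring

theorem memLp_of_continuous {M : ℕ} {ψ : E M → ℂ} (hψ : Continuous ψ) : MemLp ψ 2 (volQ M) := by
  refine (memLp_two_iff_integrable_sq_norm hψ.aestronglyMeasurable).2 ?_
  exact ((hψ.norm.pow 2).continuousOn.integrableOn_compact (isCompact_box M)).mono_set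
      (cellQ_subset M)

/-- The normalized character as an element of `L²(Q)`. -/
def charL {M : ℕ} (k : Fin M → ℤ) : L2Q M :=
  (memLp_of_continuous ((contDiff_char (n := 0) k).continuous.const_mul (normC M : ℂ))).toLp _

theorem coeFn_charL {M : ℕ} (k : Fin M → ℤ) :
    charL k =ᵐ[volQ M] fun y => (normC M : ℂ) * char k y := MemLp.coeFn_toLp _

theorem inner_charL {M : ℕ} (k : Fin M → ℤ) (u : L2Q M) :
    inner ℂ (charL k) u = (normC M : ℂ) * ∫ y, u y * conj (char k y) ∂(volQ M) := by
  rw [L2.inner_def, ← integral_const_mul]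
  refine integral_congr_ae ?_
  filter_upwards [coeFn_charL k] with y hy
  rw [hy, RCLike.inner_apply, map_mul, Complex.conj_ofReal]
  ring

theorem integral_volQ_proj {M : ℕ} (f : UnitAddTorus (Fin M) → ℂ) (hf : Continuous f) :
    ∫ y, f (proj y) ∂(volQ M) = ((2 * Real.pi) ^ M : ℝ) * ∫ t, f t ∂(haarT M) := by
  rw [integral_comp_of_measurePreserving (measurePreserving_proj M) hf.aestronglyMeasurable,
    integral_smul_measure, ← ENNReal.ofReal_pow (by positivity),
    ENNReal.toReal_ofReal (by positivity), Complex.real_smul]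

theorem integral_mFourier {M : ℕ} (k : Fin M → ℤ) :
    ∫ t, UnitAddTorus.mFourier k t ∂(haarT M) = if k = 0 then 1 else 0 := by
  have h := orthonormal_iff_ite.1 (UnitAddTorus.orthonormal_mFourier (d := Fin M)) 0 k
  rw [ContinuousMap.inner_toLp] at h
  simp only [UnitAddTorus.mFourier_zero, ContinuousMap.one_apply, map_one, mul_one, eq_comm] at h
  rw [h]
  rfl

theorem orthonormal_charL (M : ℕ) : Orthonormal ℂ (charL (M := M)) := by
  rw [orthonormal_iff_ite]
  intro k l
  rw [inner_charL]
  have h1 : ∫ y, charL l y * conj (char k y) ∂(volQ M)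
      = ∫ y, (normC M : ℂ) * UnitAddTorus.mFourier (l + -k) (proj y) ∂(volQ M) := by
    refine integral_congr_ae ?_
    filter_upwards [coeFn_charL l] with y hy
    rw [hy, UnitAddTorus.mFourier_add, mFourier_proj, mFourier_proj, char_neg, mul_assoc]
  rw [h1, integral_const_mul, integral_volQ_proj _ (UnitAddTorus.mFourier (l + -k)).continuous,
    integral_mFourier]
  have h2 : (normC M : ℂ) ^ 2 * (2 * Real.pi : ℂ) ^ M = 1 := by exact_mod_cast normC_sq M
  have h3 : l + -k = 0 ↔ k = l := by rw [← sub_eq_add_neg, sub_eq_zero, eq_comm]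
  simp only [h3]
  split_ifs
  · push_cast
    linear_combination h2
  · simp

/-- Completeness of the characters is pulled from the torus to the cell through `lift`. -/
theorem eq_zero_of_inner_charL {M : ℕ} (u : L2Q M) (h : ∀ k, inner ℂ (charL k) u = 0) :
    u = 0 := by
  set c := ENNReal.ofReal (2 * Real.pi) ^ M with hc
  have hc0 : c ≠ 0 := by
    rw [hc]; exact (ENNReal.pow_pos (ENNReal.ofReal_pos.2 (by positivity)) M).ne'
  have hct : c ≠ ⊤ := by rw [hc]; exact ENNReal.pow_ne_top ENNReal.ofReal_ne_top
  have hm : MemLp (fun t => u (lift t)) 2 (haarT M) := by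
    have h1 := ((Lp.memLp u).comp_measurePreserving (measurePreserving_lift M)).smul_measure
      (ENNReal.inv_ne_top.2 hc0)
    rwa [smul_smul, ENNReal.inv_mul_cancel hc0 hct, one_smul] at h1
  have hz : hm.toLp _ = 0 := by
    have : ∀ k, UnitAddTorus.mFourierBasis.repr (hm.toLp _) k = 0 := by
      intro k
      rw [HilbertBasis.repr_apply_apply, UnitAddTorus.coe_mFourierBasis, L2.inner_def]
      have h1 : ∫ t, inner ℂ (UnitAddTorus.mFourierLp 2 k t) (hm.toLp _ t) ∂(haarT M)
          = ∫ t, u (lift t) * conj (UnitAddTorus.mFourier k t) ∂(haarT M) := by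
        refine integral_congr_ae ?_
        filter_upwards [UnitAddTorus.coeFn_mFourierLp 2 k, hm.coeFn_toLp] with t h1 h2
        rw [h1, h2, RCLike.inner_apply]
      have h2 := h k
      rw [inner_charL] at h2
      have h3 := (mul_eq_zero.1 h2).resolve_left (by exact_mod_cast (normC_pos M).ne')
      rw [← integral_comp_of_measurePreserving (measurePreserving_lift M)
        (integrable_mul_test u (by
          have := (contDiff_char (n := 0) k).continuous
          fun_prop)).aestronglyMeasurable, integral_smul_measure] at h3
      have h4 := (smul_eq_zero.1 h3).resolve_left (ENNReal.toReal_ne_zero.2 ⟨hc0, hct⟩)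
      refine Eq.trans h1 ?_
      rw [← h4]
      refine integral_congr_ae (Eventually.of_forall fun t => ?_)
      simp only
      rw [← mFourier_proj, proj_lift]
    have h0 : UnitAddTorus.mFourierBasis.repr (hm.toLp _) = 0 := by
      ext k; exact this k
    exact (LinearIsometryEquiv.map_eq_zero_iff _).1 h0
  have h5 : ∀ᵐ t ∂(haarT M), u (lift t) = 0 := by
    filter_upwards [hm.coeFn_toLp, (Lp.eq_zero_iff_ae_eq_zero.1 hz)] with t h1 h2
    rw [← h1, h2]; rfl
  have h6 : ∀ᵐ y ∂(volQ M), u (lift (proj y)) = 0 :=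
    (measurePreserving_proj M).quasiMeasurePreserving.ae
      (Measure.ae_smul_measure h5 _)
  rw [Lp.eq_zero_iff_ae_eq_zero]
  filter_upwards [h6, lift_proj_ae M] with y h1 h2
  rw [h2] at h1
  exact h1

/-- The Fourier basis of `L²(Q)`. -/
def charBasis (M : ℕ) : HilbertBasis (Fin M → ℤ) ℂ (L2Q M) :=
  HilbertBasis.mkOfOrthogonalEqBot (orthonormal_charL M) <| by
    rw [Submodule.eq_bot_iff]
    intro u hu
    refine eq_zero_of_inner_charL u fun k => ?_
    exact (Submodule.mem_orthogonal _ _).1 hu _ (Submodule.subset_span ⟨k, rfl⟩)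

theorem charBasis_apply {M : ℕ} (k : Fin M → ℤ) : charBasis M k = charL k := by
  simp [charBasis]

/-- Fourier coefficient. -/
def coef {M : ℕ} (u : L2Q M) (k : Fin M → ℤ) : ℂ := inner ℂ (charL k) u

theorem hasSum_coef {M : ℕ} (u : L2Q M) : HasSum (fun k => ‖coef u k‖ ^ 2) (‖u‖ ^ 2) := by
  have h := (charBasis M).hasSum_inner_mul_inner u u
  have h2 := Complex.reCLM.hasSum h
  convert h2 using 1
  · funext k
    rw [charBasis_apply, coef, ← inner_conj_symm u (charL k), Complex.conj_mul']
    simp only [Complex.reCLM_apply]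
    norm_cast
  · rw [Complex.reCLM_apply]
    exact (inner_self_eq_norm_sq (𝕜 := ℂ) u).symm

/-! ### Density of the quasiperiodic winding -/

theorem wind_add {M d : ℕ} (Λ : Matrix (Fin M) (Fin d) ℝ) (x x' : E d) :
    wind Λ (x + x') = wind Λ x + wind Λ x' := by
  ext i; simp [wind, Matrix.mulVec_add]

theorem wind_sum {M d : ℕ} {ι : Type*} (Λ : Matrix (Fin M) (Fin d) ℝ) (s : Finset ι)
    (x : ι → E d) : wind Λ (∑ i ∈ s, x i) = ∑ i ∈ s, wind Λ (x i) :=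
  map_sum (AddMonoidHom.mk' (wind Λ) (wind_add Λ)) x s

theorem char_sum {M : ℕ} {ι : Type*} (k : Fin M → ℤ) (s : Finset ι) (y : ι → E M) :
    char k (∑ i ∈ s, y i) = ∏ i ∈ s, char k (y i) := by
  classical
  induction s using Finset.induction_on with
  | empty => simp [char]
  | insert i s hi ih => rw [Finset.sum_insert hi, Finset.prod_insert hi, char_add, ih]

/-- Since `k · Λx = v · x` with `v = Λᵀk ≠ 0`, the point `x = πv/|v|²` makes the phase equal to `π`.
-/
theorem exists_char_wind_eq_neg_one {M d : ℕ} {Λ : Matrix (Fin M) (Fin d) ℝ} {k : Fin M → ℤ}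
    (hk : Λᵀ *ᵥ (fun i => (k i : ℝ)) ≠ 0) : ∃ x : E d, char k (wind Λ x) = -1 := by
  obtain ⟨v, hv⟩ : ∃ v : Fin d → ℝ, v = Λᵀ *ᵥ (fun i => (k i : ℝ)) := ⟨_, rfl⟩
  rw [← hv] at hk
  have hvv : v ⬝ᵥ v ≠ 0 := by rwa [Ne, dotProduct_self_eq_zero]
  refine ⟨WithLp.toLp 2 ((Real.pi / (v ⬝ᵥ v)) • v), ?_⟩
  have h : ∑ j, (k j : ℝ) * wind Λ (WithLp.toLp 2 ((Real.pi / (v ⬝ᵥ v)) • v)) j = Real.pi := by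
    have h1 : (fun i => (k i : ℝ)) ⬝ᵥ (Λ *ᵥ ((Real.pi / (v ⬝ᵥ v)) • v)) = Real.pi := by
      have h2 : (fun i => (k i : ℝ)) ⬝ᵥ (Λ *ᵥ v) = v ⬝ᵥ v :=
        (Matrix.dotProduct_mulVec _ _ _).trans (by rw [hv, Matrix.mulVec_transpose])
      rw [Matrix.mulVec_smul, dotProduct_smul, h2, smul_eq_mul, div_mul_cancel₀ _ hvv]
    simpa only [dotProduct, wind] using h1
  rw [char, h, Complex.exp_pi_mul_I]

/-- A finite average of point evaluations on the winding that agrees with Haar measure on prescribed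
characters; it replaces an ergodic average over large balls. -/
theorem exists_average_functional {M d : ℕ} {Λ : Matrix (Fin M) (Fin d) ℝ}
    (hΛ : ∀ p : Fin M → ℤ, p ≠ 0 → Λᵀ *ᵥ (fun i => (p i : ℝ)) ≠ 0) (S : Finset (Fin M → ℤ)) :
    ∃ ℓ : C(UnitAddTorus (Fin M), ℂ) →ₗ[ℂ] ℂ, (∀ f, ‖ℓ f‖ ≤ ‖f‖) ∧
      (∀ f, (∀ x, f (proj (wind Λ x)) = 0) → ℓ f = 0) ∧
      ∀ k ∈ S, ℓ (UnitAddTorus.mFourier k) = ∫ t, UnitAddTorus.mFourier k t ∂(haarT M) := by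
  classical
  have : ∀ k : Fin M → ℤ, ∃ x : E d, k ≠ 0 → char k (wind Λ x) = -1 := by
    intro k
    by_cases hk : k = 0
    · exact ⟨0, fun h => (h hk).elim⟩
    · obtain ⟨x, hx⟩ := exists_char_wind_eq_neg_one (hΛ k hk)
      exact ⟨x, fun _ => hx⟩
  choose x hx using this
  set S' := S.erase 0
  set pt : Finset (Fin M → ℤ) → E d := fun R => ∑ k ∈ R, x k
  -- The nodes are all subset sums of the points `x k'` where the character `k'` equals -1. The sum
  -- of a character `k` over them factors as `∏ (1 + char k (Λ x k'))`, and the factor `k' = k`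
  -- vanishes. The index 0 is erased because its mean must be 1.
  let ℓ : C(UnitAddTorus (Fin M), ℂ) →ₗ[ℂ] ℂ :=
    ((2 : ℂ) ^ S'.card)⁻¹ • ∑ R ∈ S'.powerset,
      (ContinuousMap.evalCLM ℂ (proj (wind Λ (pt R)))).toLinearMap
  have hℓ : ∀ f, ℓ f = ((2 : ℂ) ^ S'.card)⁻¹ * ∑ R ∈ S'.powerset, f (proj (wind Λ (pt R))) := by
    intro f
    simp [ℓ, LinearMap.sum_apply]
  refine ⟨ℓ, fun f => ?_, fun f hf => ?_, fun k hk => ?_⟩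
  · rw [hℓ, norm_mul, norm_inv, norm_pow, Complex.norm_ofNat]
    have h1 : ‖∑ R ∈ S'.powerset, f (proj (wind Λ (pt R)))‖ ≤ 2 ^ S'.card * ‖f‖ := by
      refine (norm_sum_le_of_le _ fun R _ => f.norm_coe_le_norm _).trans ?_
      simp [Finset.card_powerset]
    calc _ ≤ ((2 : ℝ) ^ S'.card)⁻¹ * (2 ^ S'.card * ‖f‖) := by gcongr
      _ = ‖f‖ := by field_simp
  · rw [hℓ, Finset.sum_eq_zero (fun R _ => hf _), mul_zero]
  · rw [hℓ, integral_mFourier]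
    have h2 : ∑ R ∈ S'.powerset, UnitAddTorus.mFourier k (proj (wind Λ (pt R)))
        = ∏ k' ∈ S', (1 + char k (wind Λ (x k'))) := by
      rw [Finset.prod_one_add]
      refine Finset.sum_congr rfl fun R _ => ?_
      rw [mFourier_proj, wind_sum, char_sum]
    rw [h2]
    split_ifs with h0
    · subst h0
      simp only [char_zero, Finset.prod_const]
      norm_num
    · rw [Finset.prod_eq_zero (i := k) (Finset.mem_erase.2 ⟨h0, hk⟩) (by rw [hx k h0]; ring),
        mul_zero]

theorem integral_eq_zero_of_vanish_wind {M d : ℕ} {Λ : Matrix (Fin M) (Fin d) ℝ}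
    (hΛ : ∀ p : Fin M → ℤ, p ≠ 0 → Λᵀ *ᵥ (fun i => (p i : ℝ)) ≠ 0)
    (f : C(UnitAddTorus (Fin M), ℂ)) (hf : ∀ x, f (proj (wind Λ x)) = 0) :
    ∫ t, f t ∂(haarT M) = 0 := by
  have hint : ∀ h : C(UnitAddTorus (Fin M), ℂ), Integrable h (haarT M) := fun h =>
    h.continuous.integrable_of_hasCompactSupport (HasCompactSupport.of_compactSpace _)
  refine norm_le_zero_iff.1 (le_of_forall_pos_le_add fun ε hε => ?_)
  have hden : f ∈ closure
      (Submodule.span ℂ (Set.range (UnitAddTorus.mFourier (d := Fin M))) : Set _) := by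
    rw [← Submodule.topologicalClosure_coe, UnitAddTorus.span_mFourier_closure_eq_top]
    trivial
  obtain ⟨P, hP, hfP⟩ := Metric.mem_closure_iff.1 hden (ε / 2) (by positivity)
  rw [dist_eq_norm] at hfP
  obtain ⟨c, rfl⟩ := (Finsupp.mem_span_range_iff_exists_finsupp).1 hP
  obtain ⟨ℓ, h1, h2, h3⟩ := exists_average_functional hΛ c.support
  set P := c.sum fun i a => a • UnitAddTorus.mFourier (d := Fin M) i with hPdef
  have h4 : ℓ P = ∫ t, P t ∂(haarT M) := by
    have h5 : ∀ t, P t = ∑ k ∈ c.support, c k * UnitAddTorus.mFourier k t := fun t => by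
      simp [hPdef, Finsupp.sum, ContinuousMap.sum_apply]
    simp only [h5]
    rw [integral_finsetSum _ fun k _ => (hint _).const_mul _, hPdef, Finsupp.sum, map_sum]
    refine Finset.sum_congr rfl fun k hk => ?_
    rw [map_smul, h3 k hk, integral_const_mul, smul_eq_mul]
  -- `ℓ` kills `f` and is exact on the trigonometric polynomial `P`, so both remaining terms are at
  -- most `‖f - P‖ < ε/2`.
  have h6 : ∫ t, f t ∂(haarT M) = ∫ t, (f - P) t ∂(haarT M) - ℓ (f - P) := by
    rw [map_sub, h2 f hf, h4]
    simp only [ContinuousMap.sub_apply]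
    rw [integral_sub (hint f) (hint P)]
    ring
  have h7 : ‖∫ t, (f - P) t ∂(haarT M)‖ ≤ ‖f - P‖ := by
    have := norm_integral_le_of_norm_le_const (μ := haarT M)
      (Eventually.of_forall fun t => (f - P).norm_coe_le_norm t)
    simpa using this
  rw [h6]
  calc _ ≤ ‖∫ t, (f - P) t ∂(haarT M)‖ + ‖ℓ (f - P)‖ := norm_sub_le _ _
    _ ≤ 0 + ε := by linarith [h1 (f - P)]

/-- The distance to the winding is continuous, nonnegative and zero on the winding, so its integral
is zero and it vanishes identically. -/
theorem denseRange_proj_wind {M d : ℕ} {Λ : Matrix (Fin M) (Fin d) ℝ}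
    (hΛ : ∀ p : Fin M → ℤ, p ≠ 0 → Λᵀ *ᵥ (fun i => (p i : ℝ)) ≠ 0) :
    DenseRange fun x : E d => (proj (wind Λ x) : UnitAddTorus (Fin M)) := by
  set s : Set (UnitAddTorus (Fin M)) := Set.range fun x : E d => proj (wind Λ x) with hs
  have hne : s.Nonempty := Set.range_nonempty _
  set f : UnitAddTorus (Fin M) → ℝ := fun t => Metric.infDist t s with hf
  have hfc : Continuous f := Metric.continuous_infDist_pt s
  have h0 : ∫ t, ((f t : ℝ) : ℂ) ∂(haarT M) = 0 :=
    integral_eq_zero_of_vanish_wind hΛ ⟨fun t => (f t : ℂ), by fun_prop⟩ fun x => by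
      simpa [hf] using Metric.infDist_zero_of_mem (Set.mem_range_self x)
  rw [integral_complex_ofReal] at h0
  have h0' : ∫ t, f t ∂(haarT M) = 0 := by exact_mod_cast h0
  have hint : Integrable f (haarT M) :=
    hfc.integrable_of_hasCompactSupport (HasCompactSupport.of_compactSpace _)
  have h1 := (integral_eq_zero_iff_of_nonneg (fun t => Metric.infDist_nonneg) hint).1 h0'
  have h2 : f = 0 := (Continuous.ae_eq_iff_eq (haarT M) hfc continuous_const).1 h1
  intro t
  rw [Metric.mem_closure_iff_infDist_zero hne]
  exact congr_fun h2 t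

theorem isOpenMap_proj {M : ℕ} : IsOpenMap (proj : E M → UnitAddTorus (Fin M)) := by
  have h1 : IsOpenMap fun (z : Fin M → ℝ) (i : Fin M) => ((z i : ℝ) : UnitAddCircle) :=
    IsOpenMap.piMap (fun _ => QuotientAddGroup.isOpenMap_coe) (by
      refine Eventually.of_forall fun i => QuotientAddGroup.mk_surjective)
  have h2 : IsOpenMap fun y : E M => (WithLp.ofLp y : Fin M → ℝ) :=
    (PiLp.homeomorph 2 (fun _ : Fin M => ℝ)).isOpenMap
  have h3 : IsOpenMap fun y : E M => (2 * Real.pi)⁻¹ • y :=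
    isOpenMap_smul₀ (by positivity)
  convert h1.comp (h2.comp h3) using 1
  funext y i
  simp [proj, div_eq_inv_mul]

/-- The device by which closed conditions on `A(x) = B(Λx)` become conditions on `B(y)` for every
`y`. Openness of `proj` turns density in the torus into density upstairs. -/
theorem QPeriodic.mem_of_isClosed {M d : ℕ} {α : Type*} [TopologicalSpace α]
    {Λ : Matrix (Fin M) (Fin d) ℝ}
    (hΛ : ∀ p : Fin M → ℤ, p ≠ 0 → Λᵀ *ᵥ (fun i => (p i : ℝ)) ≠ 0) {f : E M → α}
    (hf : QPeriodic f) (hc : Continuous f) {C : Set α} (hC : IsClosed C)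
    (h : ∀ x, f (wind Λ x) ∈ C) (y : E M) : f y ∈ C := by
  have hd := (denseRange_proj_wind hΛ).preimage isOpenMap_proj
  have h1 : proj ⁻¹' (Set.range fun x : E d => (proj (wind Λ x) : UnitAddTorus (Fin M)))
      ⊆ f ⁻¹' C := by
    rintro z ⟨x, hx⟩
    rw [Set.mem_preimage, ← hf.eq_of_proj_eq hx]
    exact h x
  exact (hC.preimage hc).closure_subset_iff.2 h1 (hd y)

/-! ### The coefficient matrix at every point of the cell -/

section Coeff

variable {M d : ℕ} {Λ : Matrix (Fin M) (Fin d) ℝ} {B : E M → Matrix (Fin d) (Fin d) ℝ}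

theorem IsQuasiperiodicCoeff.continuous (hB : IsQuasiperiodicCoeff Λ B) : Continuous B :=
  continuous_matrix fun k l => (hB.smooth k l).continuous

theorem IsQuasiperiodicCoeff.symm_all (hB : IsQuasiperiodicCoeff Λ B) (y : E M) (k l : Fin d) :
    B y k l = B y l k := by
  have hC : IsClosed {A : Matrix (Fin d) (Fin d) ℝ | A k l = A l k} :=
    isClosed_eq (by fun_prop) (by fun_prop)
  exact hB.periodic.mem_of_isClosed hB.irrational hB.continuous hC
    (fun x => (hB.symm x).apply l k) y

theorem continuous_wind (Λ : Matrix (Fin M) (Fin d) ℝ) : Continuous (wind Λ) := by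
  refine (PiLp.continuous_toLp 2 _).comp ?_
  exact Continuous.matrix_mulVec continuous_const (PiLp.continuous_ofLp 2 _)

theorem IsQuasiperiodicCoeff.nonneg (hB : IsQuasiperiodicCoeff Λ B) (y : E M) (v : Fin d → ℝ) :
    0 ≤ ∑ k, ∑ l, B y k l * v l * v k := by
  obtain ⟨α, hα, hae⟩ := hB.coercive
  have hC : IsClosed {A : Matrix (Fin d) (Fin d) ℝ | 0 ≤ ∑ k, ∑ l, A k l * v l * v k} :=
    isClosed_le continuous_const (by fun_prop)
  refine hB.periodic.mem_of_isClosed hB.irrational hB.continuous hC (fun x => ?_) y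
  have hcl : IsClosed {x : E d | 0 ≤ ∑ k, ∑ l, B (wind Λ x) k l * v l * v k} :=
    hC.preimage (hB.continuous.comp (continuous_wind Λ))
  -- Coercivity is known only for a.e. `x`; a set of full measure is dense, and closedness then
  -- gives every `x`.
  have hde : Dense {x : E d | 0 ≤ ∑ k, ∑ l, B (wind Λ x) k l * v l * v k} := by
    refine Measure.dense_of_ae (μ := volume) ?_
    filter_upwards [hae] with x hx
    exact le_trans (by positivity) (hx (WithLp.toLp 2 v))
  have := hde x
  rwa [hcl.closure_eq] at this

end Coeff

/-! ### Periodic functions -/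

theorem QPeriodic.exists_bound {M : ℕ} {F : Type*} [NormedAddCommGroup F] {f : E M → F}
    (hf : QPeriodic f) (hc : Continuous f) : ∃ C, ∀ y, ‖f y‖ ≤ C := by
  obtain ⟨C, hC⟩ := (isCompact_box M).exists_bound_of_continuousOn hc.continuousOn
  refine ⟨C, fun y => ?_⟩
  rw [← hf.comp_lift_proj y]
  refine hC _ ⟨fun i => ?_, fun i => ?_⟩
  · have := (AddCircle.equivIoc (1 : ℝ) 0 (proj y i)).2.1
    simp only [lift, Pi.zero_apply]
    positivity
  · have := (AddCircle.equivIoc (1 : ℝ) 0 (proj y i)).2.2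
    simp only [lift]
    nlinarith [Real.pi_pos]

theorem QPeriodic.translate {M : ℕ} {α : Type*} {f : E M → α} (hf : QPeriodic f) (z : E M) :
    QPeriodic fun y => f (y + z) := fun i y => by
  simpa only [add_right_comm] using hf i (y + z)

theorem QPeriodic.fderiv {M : ℕ} {F : Type*} [NormedAddCommGroup F] [NormedSpace ℝ F]
    {f : E M → F} (hf : QPeriodic f) : QPeriodic (fderiv ℝ f) := fun i y => by
  rw [← fderiv_comp_add_right]
  congr 1
  funext z
  exact hf i z

theorem QPeriodic.partialDeriv {M : ℕ} {ψ : E M → ℂ} (hψ : QPeriodic ψ) (m : Fin M) :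
    QPeriodic (partialDeriv m ψ) := fun i y => by
  simp only [QuasiBloch.partialDeriv, hψ.fderiv i y]

theorem single_smul_one {M : ℕ} (m : Fin M) (s : ℝ) :
    EuclideanSpace.single m s = s • EuclideanSpace.single m (1 : ℝ) := by
  ext i; by_cases h : i = m <;> simp [h]

theorem hasDerivAt_translate {M : ℕ} {F : Type*} [NormedAddCommGroup F] [NormedSpace ℝ F]
    {f : E M → F} (hf : Differentiable ℝ f) (m : Fin M) (y : E M) (s : ℝ) :
    HasDerivAt (fun s : ℝ => f (y + EuclideanSpace.single m s))
      (fderiv ℝ f (y + EuclideanSpace.single m s) (EuclideanSpace.single m 1)) s := by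
  have h : HasDerivAt (fun s : ℝ => y + EuclideanSpace.single m s)
      (EuclideanSpace.single m (1 : ℝ)) s := by
    have h1 := ((hasDerivAt_id s).smul_const (EuclideanSpace.single m (1 : ℝ))).const_add y
    simpa only [id, ← single_smul_one] using h1
  exact (hf _).hasFDerivAt.comp_hasDerivAt s h

/-- Differentiate in `s` the integral of `ψ(y + s eₘ)`, which is constant by translation invariance.
-/
theorem integral_partialDeriv_eq_zero {M : ℕ} (m : Fin M) {ψ : E M → ℂ} (hs : ContDiff ℝ ∞ ψ)
    (hp : QPeriodic ψ) : ∫ y, partialDeriv m ψ y ∂(volQ M) = 0 := by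
  obtain ⟨C, hC⟩ := (hp.partialDeriv m).exists_bound (continuous_partialDeriv m hs)
  have hint : ∀ χ : E M → ℂ, Continuous χ → Integrable χ (volQ M) := fun χ hχ =>
    (memLp_of_continuous hχ).integrable one_le_two
  have h0 : (fun y : E M => y + EuclideanSpace.single m (0 : ℝ)) = id := by
    funext y; simp [single_smul_one m 0]
  have h := (hasDerivAt_integral_of_dominated_loc_of_deriv_le (μ := volQ M) (𝕜 := ℝ)
    (F := fun s y => ψ (y + EuclideanSpace.single m s))
    (F' := fun s y => partialDeriv m ψ (y + EuclideanSpace.single m s))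
    (bound := fun _ => C) (x₀ := 0) (s := Set.univ) univ_mem
    (Eventually.of_forall fun s => by
      have := hs.continuous
      exact Continuous.aestronglyMeasurable (by fun_prop))
    (hint _ (hs.continuous.comp (by fun_prop)))
    (((continuous_partialDeriv m hs).comp (by fun_prop)).aestronglyMeasurable)
    (Eventually.of_forall fun y s _ => hC _) (integrable_const C)
    (Eventually.of_forall fun y s _ =>
      hasDerivAt_translate (hs.differentiable (by simp)) m y s)).2
  have hconst : ∀ s, ∫ y, ψ (y + EuclideanSpace.single m s) ∂(volQ M) = ∫ y, ψ y ∂(volQ M) := by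
    intro s
    rw [← integral_comp_of_measurePreserving (measurePreserving_shift m s)
      hs.continuous.aestronglyMeasurable]
    simp only [hp.comp_shift]
  simp only [hconst] at h
  have h1 := h.unique (hasDerivAt_const (0 : ℝ) _)
  simpa [single_smul_one m 0] using h1

/-! ### The Hilbert space `H¹_♯(Q)` -/

/-- `conj χ` as an element of `L²(Q)`, for continuous `χ`. -/
def testL {M : ℕ} {χ : E M → ℂ} (hχ : Continuous χ) : L2Q M :=
  (memLp_of_continuous (hχ.star)).toLp _

theorem inner_testL {M : ℕ} {χ : E M → ℂ} (hχ : Continuous χ) (u : L2Q M) :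
    inner ℂ (testL hχ) u = ∫ y, u y * χ y ∂(volQ M) := by
  rw [L2.inner_def]
  refine integral_congr_ae ?_
  filter_upwards [(memLp_of_continuous (hχ.star)).coeFn_toLp] with y hy
  rw [testL, hy, RCLike.inner_apply, ← starRingEnd_apply, Complex.conj_conj]

/-- Each test function imposes an equality of two continuous functionals of the pair `(u, ∇u)`. -/
theorem isClosed_H1 (M : ℕ) : IsClosed (H1 M : Set
    (WithLp 2 (L2Q M × PiLp 2 (fun _ : Fin M => L2Q M)))) := by
  have h : (H1 M : Set (WithLp 2 (L2Q M × PiLp 2 (fun _ : Fin M => L2Q M)))) =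
      ⋂ (m : Fin M) (ψ : E M → ℂ) (hs : ContDiff ℝ ∞ ψ) (_ : QPeriodic ψ),
        {p | inner ℂ (testL (continuous_partialDeriv m hs)) p.fst
          = - inner ℂ (testL hs.continuous) (p.snd m)} := by
    ext p
    simp only [Set.mem_iInter, Set.mem_ofPred_eq, inner_testL]
    rfl
  rw [h]
  refine isClosed_iInter fun m => isClosed_iInter fun ψ => isClosed_iInter fun hs =>
    isClosed_iInter fun hp => isClosed_eq ?_ ?_
  · exact continuous_const.inner (WithLp.fstL 2 ℂ (L2Q M) _).continuous
  · exact (continuous_const.inner ((PiLp.proj 2 (𝕜 := ℂ) (fun _ : Fin M => L2Q M) m).continuous.comp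
      (WithLp.sndL 2 ℂ (L2Q M) _).continuous)).neg

instance completeSpace_H1 (M : ℕ) : CompleteSpace (H1 M) :=
  (isClosed_H1 M).completeSpace_coe

/-- `H¹_♯(Q)` as a Hilbert space in its own right. -/
def HS (M : ℕ) : Type := H1 M

instance (M : ℕ) : NormedAddCommGroup (HS M) := inferInstanceAs (NormedAddCommGroup (H1 M))

instance (M : ℕ) : InnerProductSpace ℂ (HS M) := inferInstanceAs (InnerProductSpace ℂ (H1 M))

instance (M : ℕ) : CompleteSpace (HS M) := completeSpace_H1 M

/-- The identity `HS M → H¹_♯(Q)`. -/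
def ofHS (M : ℕ) : HS M →L[ℂ] H1 M := ContinuousLinearMap.id ℂ (H1 M)

/-- The embedding `H¹_♯(Q) → L²(Q)`. -/
def emb (M : ℕ) : HS M →L[ℂ] L2Q M := (WithLp.fstL 2 ℂ (L2Q M) _).comp ((H1 M).subtypeL.comp (ofHS M))

/-- The partial derivative `H¹_♯(Q) → L²(Q)`. -/
def grad {M : ℕ} (m : Fin M) : HS M →L[ℂ] L2Q M :=
  (PiLp.proj 2 (𝕜 := ℂ) (fun _ : Fin M => L2Q M) m).comp
    ((WithLp.sndL 2 ℂ (L2Q M) _).comp ((H1 M).subtypeL.comp (ofHS M)))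

theorem emb_apply {M : ℕ} (u : HS M) : emb M u = h1Fn (ofHS M u) := rfl

theorem grad_apply {M : ℕ} (m : Fin M) (u : HS M) : grad m u = h1Grad (ofHS M u) m := rfl

theorem norm_sq_HS {M : ℕ} (u : HS M) : ‖u‖ ^ 2 = ‖emb M u‖ ^ 2 + ∑ m, ‖grad m u‖ ^ 2 := by
  have h : ‖u‖ = ‖u.1‖ := rfl
  rw [h, WithLp.prod_norm_sq_eq_of_L2, PiLp.norm_sq_eq_of_L2]
  rfl

theorem HS.ext' {M : ℕ} {u v : HS M} (h : emb M u = emb M v) (hg : ∀ m, grad m u = grad m v) :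
    u = v := by
  rw [← sub_eq_zero, ← norm_eq_zero, ← sq_eq_zero_iff, norm_sq_HS]
  simp [h, hg]

/-- This is the weak derivative tested against `e^{-ik·y}`. -/
theorem coef_grad {M : ℕ} (u : HS M) (m : Fin M) (k : Fin M → ℤ) :
    coef (grad m u) k = Complex.I * (k m : ℂ) * coef (emb M u) k := by
  have h := u.2 m (char (-k)) (contDiff_char _) (qPeriodic_char _)
  simp only [partialDeriv_char, Pi.neg_apply, Int.cast_neg, char_neg] at h
  have h1 : ∫ y, u.1.fst y * (Complex.I * -(k m : ℂ) * conj (char k y)) ∂(volQ M)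
      = -(Complex.I * (k m : ℂ)) * ∫ y, u.1.fst y * conj (char k y) ∂(volQ M) := by
    rw [← integral_const_mul]
    congr 1
    funext y
    ring
  rw [h1] at h
  rw [coef, coef, inner_charL, inner_charL]
  change _ * ∫ y, u.1.snd m y * _ ∂(volQ M) = _ * (_ * ∫ y, u.1.fst y * _ ∂(volQ M))
  linear_combination (normC M : ℂ) * h

/-- Parseval: a nonzero integer vector has some `|k_m| ≥ 1`, so each nonconstant mode is dominated
by the same mode of one partial derivative. -/
theorem poincare {M : ℕ} (u : HS M) :
    ‖emb M u‖ ^ 2 ≤ ‖coef (emb M u) 0‖ ^ 2 + ∑ m, ‖grad m u‖ ^ 2 := by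
  have h1 := hasSum_coef (emb M u)
  have h2 : HasSum (fun k : Fin M → ℤ => if k = 0 then ‖coef (emb M u) 0‖ ^ 2 else 0)
      (‖coef (emb M u) 0‖ ^ 2) := hasSum_ite_eq 0 _
  have h3 := h2.add (hasSum_sum (s := Finset.univ) fun m _ => hasSum_coef (grad m u))
  refine hasSum_le (fun k => ?_) h1 h3
  simp only [coef_grad]
  split_ifs with hk
  · rw [hk]
    exact le_add_of_nonneg_right (Finset.sum_nonneg fun _ _ => by positivity)
  · obtain ⟨m, hm⟩ := Function.ne_iff.1 hk
    have h4 : (1 : ℝ) ≤ ‖(k m : ℂ)‖ := by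
      rw [Complex.norm_intCast]
      exact_mod_cast Int.one_le_abs hm
    have h5 := Finset.single_le_sum (f := fun m => ‖Complex.I * (k m : ℂ) * coef (emb M u) k‖ ^ 2)
      (fun _ _ => by positivity) (Finset.mem_univ m)
    rw [zero_add]
    refine le_trans ?_ h5
    simp only [norm_mul, Complex.norm_I, one_mul]
    exact pow_le_pow_left₀ (norm_nonneg _) (le_mul_of_one_le_left (norm_nonneg _) h4) 2

/-- The normalized constant function, as an element of `H¹_♯(Q)`. -/
def constH (M : ℕ) : HS M :=
  ⟨WithLp.toLp 2 (charL 0, 0), by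
    intro m ψ hs hp
    have h1 : ∫ y, charL (M := M) 0 y * partialDeriv m ψ y ∂(volQ M) = 0 := by
      rw [integral_congr_ae (g := fun y => (normC M : ℂ) * partialDeriv m ψ y),
        integral_const_mul, integral_partialDeriv_eq_zero m hs hp, mul_zero]
      filter_upwards [coeFn_charL (M := M) 0] with y hy
      rw [hy, char_zero, mul_one]
    have h2 : ∫ y, (0 : L2Q M) y * ψ y ∂(volQ M) = 0 := by
      rw [← inner_testL hs.continuous, inner_zero_right]
    exact h1.trans (by rw [← neg_zero, ← h2]; rfl)⟩

theorem emb_constH (M : ℕ) : emb M (constH M) = charL 0 := rfl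

theorem grad_constH {M : ℕ} (m : Fin M) : grad m (constH M) = 0 := rfl

/-! ### Translations -/

/-- Translation on `L²(Q)`. -/
def transL {M : ℕ} (m : Fin M) (s : ℝ) : L2Q M →ₗᵢ[ℂ] L2Q M :=
  Lp.compMeasurePreservingₗᵢ ℂ (shift m s) (measurePreserving_shift m s)

theorem coeFn_transL {M : ℕ} (m : Fin M) (s : ℝ) (u : L2Q M) :
    transL m s u =ᵐ[volQ M] fun y => u (shift m s y) :=
  Lp.coeFn_compMeasurePreserving u (measurePreserving_shift m s)

theorem transL_neg_transL {M : ℕ} (m : Fin M) (s : ℝ) (u : L2Q M) :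
    transL m s (transL m (-s) u) = u := by
  refine Lp.ext ?_
  have h := (measurePreserving_shift m s).quasiMeasurePreserving.ae (coeFn_transL m (-s) u)
  filter_upwards [coeFn_transL m s (transL m (-s) u), h, shift_zero_ae m] with y h1 h2 h3
  rw [h1, h2, shift_shift, add_neg_cancel, h3]

theorem integral_transL_mul {M : ℕ} (m : Fin M) (s : ℝ) (u : L2Q M) {χ : E M → ℂ}
    (hc : Continuous χ) (hp : QPeriodic χ) :
    ∫ y, transL m s u y * χ (y + EuclideanSpace.single m s) ∂(volQ M)
      = ∫ y, u y * χ y ∂(volQ M) := by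
  rw [← integral_comp_of_measurePreserving (measurePreserving_shift m s)
    (integrable_mul_test u hc).aestronglyMeasurable]
  refine integral_congr_ae ?_
  filter_upwards [coeFn_transL m s u] with y hy
  rw [hy, hp.comp_shift]

theorem HasWeakPartial.transL {M : ℕ} {j : Fin M} {u G : L2Q M} (h : HasWeakPartial j u G)
    (m : Fin M) (s : ℝ) : HasWeakPartial j (transL m s u) (transL m s G) := by
  intro ψ hs hp
  have hs' : ContDiff ℝ ∞ fun y => ψ (y + EuclideanSpace.single m (-s)) :=
    hs.comp (contDiff_id.add contDiff_const)
  have hp' := hp.translate (EuclideanSpace.single m (-s))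
  have hz : ∀ y : E M, y + EuclideanSpace.single m s + EuclideanSpace.single m (-s) = y := by
    intro y
    rw [single_smul_one m s, single_smul_one m (-s), neg_smul, add_neg_cancel_right]
  have h1 := integral_transL_mul m s u (continuous_partialDeriv j hs') (hp'.partialDeriv j)
  have h2 := integral_transL_mul m s G hs'.continuous hp'
  have h3 : ∀ y, partialDeriv j (fun y => ψ (y + EuclideanSpace.single m (-s)))
      (y + EuclideanSpace.single m s) = partialDeriv j ψ y := by
    intro y
    rw [partialDeriv, fderiv_comp_add_right, hz, partialDeriv]
  simp only [h3, hz] at h1 h2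
  rw [h1, h2]
  exact h _ hs' hp'

/-- Translation on `H¹_♯(Q)`. -/
def transH {M : ℕ} (m : Fin M) (s : ℝ) (u : HS M) : HS M :=
  ⟨WithLp.toLp 2 (transL m s (emb M u), WithLp.toLp 2 fun j => transL m s (grad j u)),
    fun j => (u.2 j).transL m s⟩

theorem emb_transH {M : ℕ} (m : Fin M) (s : ℝ) (u : HS M) :
    emb M (transH m s u) = transL m s (emb M u) := rfl

theorem grad_transH {M : ℕ} (m j : Fin M) (s : ℝ) (u : HS M) :
    grad j (transH m s u) = transL m s (grad j u) := rfl

theorem transH_neg_transH {M : ℕ} (m : Fin M) (s : ℝ) (u : HS M) :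
    transH m s (transH m (-s) u) = u :=
  HS.ext' (transL_neg_transL m s _) fun _ => transL_neg_transL m s _

/-- Translation is diagonal on characters. For `k = 0` the factor is 1: translates keep their mean,
which `transH_eq_smul_sol` needs. -/
theorem coef_transL {M : ℕ} (m : Fin M) (s : ℝ) (u : L2Q M) (k : Fin M → ℤ) :
    coef (transL m s u) k = Complex.exp (Complex.I * (k m : ℂ) * s) * coef u k := by
  have h := integral_transL_mul m s u (χ := char (-k)) (contDiff_char (n := 0) _).continuous
    (qPeriodic_char _)
  have hs : char (-k) (EuclideanSpace.single m s) = Complex.exp (-(Complex.I * (k m : ℂ) * s)) := by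
    rw [char]
    congr 1
    simp
    ring
  simp only [char_add, hs, ← mul_assoc, integral_mul_const] at h
  simp only [char_neg] at h
  rw [coef, coef, inner_charL, inner_charL, ← h, Complex.exp_neg]
  field_simp [Complex.exp_ne_zero]

/-! ### Smooth periodic multipliers -/

/-- A smooth `Q`-periodic real function. -/
structure SmoothPer (M : ℕ) where
  toFun : E M → ℝ
  smooth : ContDiff ℝ ∞ toFun
  periodic : QPeriodic toFun

namespace SmoothPer

variable {M : ℕ}

/-- The associated bounded continuous complex function. -/
def bcf (b : SmoothPer M) : BoundedContinuousFunction (E M) ℂ :=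
  BoundedContinuousFunction.ofNormedAddCommGroup (fun y => (b.toFun y : ℂ))
    (Complex.continuous_ofReal.comp b.smooth.continuous)
    (b.periodic.exists_bound b.smooth.continuous).choose fun y => by
      rw [Complex.norm_real]
      exact (b.periodic.exists_bound b.smooth.continuous).choose_spec y

theorem bcf_apply (b : SmoothPer M) (y : E M) : b.bcf y = (b.toFun y : ℂ) := rfl

/-- Translation by `s` in the `m`-th coordinate. -/
def tr (b : SmoothPer M) (m : Fin M) (s : ℝ) : SmoothPer M where
  toFun y := b.toFun (y + EuclideanSpace.single m s)
  smooth := b.smooth.comp (contDiff_id.add contDiff_const)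
  periodic := b.periodic.translate _

/-- The partial derivative in the `m`-th coordinate. -/
def pderiv (b : SmoothPer M) (m : Fin M) : SmoothPer M where
  toFun y := fderiv ℝ b.toFun y (EuclideanSpace.single m 1)
  smooth := (b.smooth.fderiv_right (by simp)).clm_apply contDiff_const
  periodic := fun i y => by simp only [b.periodic.fderiv i y]

theorem hasDerivAt_apply (b : SmoothPer M) (m : Fin M) (y : E M) (s : ℝ) :
    HasDerivAt (fun s => (b.tr m s).toFun y) (((b.pderiv m).tr m s).toFun y) s :=
  hasDerivAt_translate (b.smooth.differentiable (by simp)) m y s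

theorem exists_lipschitz (b : SmoothPer M) (m : Fin M) :
    ∃ C, 0 ≤ C ∧ ∀ y s t, |(b.tr m s).toFun y - (b.tr m t).toFun y| ≤ C * |s - t| := by
  obtain ⟨C, hC⟩ := (b.pderiv m).periodic.exists_bound (b.pderiv m).smooth.continuous
  refine ⟨C, (norm_nonneg _).trans (hC 0), fun y s t => ?_⟩
  exact Convex.norm_image_sub_le_of_norm_hasDerivWithin_le (f := fun s => (b.tr m s).toFun y)
    (fun s _ => (b.hasDerivAt_apply m y s).hasDerivWithinAt) (fun s _ => hC _) convex_univ
    (Set.mem_univ t) (Set.mem_univ s)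

/-- Differentiability holds in the sup norm because periodicity makes the Lipschitz constant of the
derivative uniform in `y`, giving a remainder `C h²`. -/
theorem hasDerivAt_bcf (b : SmoothPer M) (m : Fin M) (s : ℝ) :
    HasDerivAt (fun s => (b.tr m s).bcf) ((b.pderiv m).tr m s).bcf s := by
  obtain ⟨C, hC0, hC⟩ := (b.pderiv m).exists_lipschitz m
  rw [hasDerivAt_iff_isLittleO_nhds_zero]
  refine Asymptotics.IsBigO.trans_isLittleO (g := fun h : ℝ => h ^ 2) ?_
    (Asymptotics.isLittleO_pow_id one_lt_two)
  refine Asymptotics.IsBigO.of_bound C (Eventually.of_forall fun h => ?_)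
  rw [BoundedContinuousFunction.norm_le (by positivity)]
  intro y
  -- With the linear part subtracted, the derivative in `r` is at most `C|h|`, so the mean value
  -- inequality yields `C|h|²`.
  have h1 : ∀ r ∈ Set.uIcc s (s + h), HasDerivWithinAt
      (fun r => (b.tr m r).toFun y - r * ((b.pderiv m).tr m s).toFun y)
      (((b.pderiv m).tr m r).toFun y - 1 * ((b.pderiv m).tr m s).toFun y)
      (Set.uIcc s (s + h)) r := fun r _ =>
    ((b.hasDerivAt_apply m y r).sub ((hasDerivAt_id r).mul_const _)).hasDerivWithinAt
  have h2 : ∀ r ∈ Set.uIcc s (s + h),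
      ‖((b.pderiv m).tr m r).toFun y - 1 * ((b.pderiv m).tr m s).toFun y‖ ≤ C * |h| := by
    intro r hr
    rw [one_mul]
    refine (hC y r s).trans (mul_le_mul_of_nonneg_left ?_ hC0)
    simpa using Set.abs_sub_left_of_mem_uIcc hr
  have h3 := Convex.norm_image_sub_le_of_norm_hasDerivWithin_le h1 h2 (convex_uIcc _ _)
    Set.left_mem_uIcc Set.right_mem_uIcc
  have h4 : ((b.tr m (s + h)).bcf - (b.tr m s).bcf - h • ((b.pderiv m).tr m s).bcf) y
      = (((b.tr m (s + h)).toFun y - (s + h) * ((b.pderiv m).tr m s).toFun y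
        - ((b.tr m s).toFun y - s * ((b.pderiv m).tr m s).toFun y) : ℝ) : ℂ) := by
    simp only [BoundedContinuousFunction.sub_apply, BoundedContinuousFunction.smul_apply, bcf_apply,
      Complex.real_smul]
    push_cast
    ring
  rw [h4, Complex.norm_real]
  refine h3.trans (le_of_eq ?_)
  rw [add_sub_cancel_left, Real.norm_eq_abs, norm_pow, Real.norm_eq_abs]
  ring

theorem contDiff_bcf (b : SmoothPer M) (m : Fin M) :
    ContDiff ℝ ∞ fun s => (b.tr m s).bcf := by
  rw [contDiff_infty]
  intro n
  induction n generalizing b with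
  | zero =>
    exact contDiff_zero.2 (continuous_iff_continuousAt.2 fun s =>
      (b.hasDerivAt_bcf m s).continuousAt)
  | succ n ih =>
    push_cast
    rw [contDiff_succ_iff_deriv]
    refine ⟨fun s => (b.hasDerivAt_bcf m s).differentiableAt, by simp, ?_⟩
    have : deriv (fun s => (b.tr m s).bcf) = fun s => ((b.pderiv m).tr m s).bcf :=
      funext fun s => (b.hasDerivAt_bcf m s).deriv
    rw [this]
    exact ih _

end SmoothPer

/-- Multiplication operators on `L²(Q)`. -/
def mulL (M : ℕ) : BoundedContinuousFunction (E M) ℂ →L[ℂ] (L2Q M →L[ℂ] L2Q M) :=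
  ((ContinuousLinearMap.mul ℂ ℂ).holderL (volQ M) ⊤ 2 2).comp
    (BoundedContinuousFunction.toLp ⊤ (volQ M) ℂ)

theorem coeFn_mulL {M : ℕ} (b : BoundedContinuousFunction (E M) ℂ) (u : L2Q M) :
    mulL M b u =ᵐ[volQ M] fun y => b y * u y := by
  have h := ContinuousLinearMap.coeFn_holder (r := 2) (ContinuousLinearMap.mul ℂ ℂ)
    (BoundedContinuousFunction.toLp ⊤ (volQ M) ℂ b) u
  filter_upwards [h, BoundedContinuousFunction.coeFn_toLp ⊤ (volQ M) ℂ b] with y h1 h2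
  rw [← h2]
  exact h1

/-! ### The operator of the regularized problem -/

section Operator

variable {M d : ℕ} (Λ : Matrix (Fin M) (Fin d) ℝ)

/-- The adjoint of `emb`. -/
def embAdj (M : ℕ) : L2Q M →L[ℂ] HS M := (emb M).adjoint

/-- The adjoint of `grad`. -/
def gradAdj {M : ℕ} (m : Fin M) : L2Q M →L[ℂ] HS M := (grad m).adjoint

theorem inner_embAdj {M : ℕ} (v : HS M) (w : L2Q M) :
    inner ℂ v (embAdj M w) = inner ℂ (emb M v) w :=
  ContinuousLinearMap.adjoint_inner_right (emb M) v w

theorem inner_gradAdj {M : ℕ} (m : Fin M) (v : HS M) (w : L2Q M) :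
    inner ℂ v (gradAdj m w) = inner ℂ (grad m v) w :=
  ContinuousLinearMap.adjoint_inner_right (grad m) v w

/-- The `l`-th component of `D + iη`, as an operator `H¹_♯(Q) → L²(Q)`. -/
def sgrad (l : Fin d) (η : E d) : HS M →L[ℂ] L2Q M :=
  ∑ m, (Λ m l : ℂ) • grad m + (Complex.I * (η l : ℂ)) • emb M

/-- The adjoint of `sgrad`. -/
def sgradAdj (k : Fin d) (η : E d) : L2Q M →L[ℂ] HS M :=
  ∑ m, (Λ m k : ℂ) • gradAdj m - (Complex.I * (η k : ℂ)) • embAdj M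

theorem inner_sgradAdj (k : Fin d) (η : E d) (v : HS M) (w : L2Q M) :
    inner ℂ v (sgradAdj Λ k η w) = inner ℂ (sgrad Λ k η v) w := by
  simp only [sgradAdj, sgrad, sub_apply, add_apply,
    sum_apply, smul_apply, inner_sub_right, inner_add_left,
    inner_sum, sum_inner, inner_smul_right, inner_smul_left, inner_embAdj, inner_gradAdj,
    map_mul, Complex.conj_ofReal, Complex.conj_I, neg_mul]
  rw [sub_eq_add_neg]

theorem coeFn_sgrad (l : Fin d) (η : E d) (u : HS M) :
    sgrad Λ l η u =ᵐ[volQ M] shiftedGrad Λ η (ofHS M u) l := by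
  have h1 : sgrad Λ l η u = ∑ m, (Λ m l : ℂ) • h1Grad (ofHS M u) m
      + (Complex.I * (η l : ℂ)) • h1Fn (ofHS M u) := by
    simp only [sgrad, add_apply, sum_apply, smul_apply, grad_apply, emb_apply]
  rw [h1]
  have h2 : ∀ s : Finset (Fin M), (∑ m ∈ s, (Λ m l : ℂ) • h1Grad (ofHS M u) m : L2Q M) =ᵐ[volQ M]
      fun y => ∑ m ∈ s, (Λ m l : ℂ) * h1Grad (ofHS M u) m y := by
    intro s
    induction s using Finset.induction_on with
    | empty => exact Lp.coeFn_zero ℂ 2 (volQ M)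
    | insert m s hm ih =>
      simp only [Finset.sum_insert hm]
      filter_upwards [ih, Lp.coeFn_add ((Λ m l : ℂ) • h1Grad (ofHS M u) m)
        (∑ m ∈ s, (Λ m l : ℂ) • h1Grad (ofHS M u) m), Lp.coeFn_smul (Λ m l : ℂ) (h1Grad (ofHS M u) m)]
        with y h1 h2 h3
      rw [h2, Pi.add_apply, h1, h3, Pi.smul_apply, smul_eq_mul]
  filter_upwards [h2 Finset.univ, Lp.coeFn_add (∑ m, (Λ m l : ℂ) • h1Grad (ofHS M u) m)
    ((Complex.I * (η l : ℂ)) • h1Fn (ofHS M u)), Lp.coeFn_smul (Complex.I * (η l : ℂ)) (h1Fn (ofHS M u))]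
    with y h1 h2 h3
  rw [h2, Pi.add_apply, h1, h3, Pi.smul_apply, smul_eq_mul, shiftedGrad]

/-- The operator `-(D + iη)·b(D + iη) - δΔ` on `H¹_♯(Q)`. -/
def opA (b : Fin d → Fin d → SmoothPer M) (δ : ℝ) (η : E d) : HS M →L[ℂ] HS M :=
  ∑ k, ∑ l, (sgradAdj Λ k η).comp ((mulL M (b k l).bcf).comp (sgrad Λ l η))
    + (δ : ℂ) • ∑ m, (gradAdj m).comp (grad m)

theorem inner_opA (b : Fin d → Fin d → SmoothPer M) (δ : ℝ) (η : E d) (u v : HS M) :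
    inner ℂ v (opA Λ b δ η u) =
      ∑ k, ∑ l, inner ℂ (sgrad Λ k η v) (mulL M (b k l).bcf (sgrad Λ l η u))
        + (δ : ℂ) * ∑ m, inner ℂ (grad m v) (grad m u) := by
  simp only [opA, add_apply, sum_apply,
    smul_apply, ContinuousLinearMap.comp_apply, inner_add_right, inner_sum,
    inner_sgradAdj, inner_smul_right, inner_gradAdj]

theorem inner_mulL (b : SmoothPer M) (u v : L2Q M) :
    inner ℂ v (mulL M b.bcf u) = ∫ y, (b.toFun y : ℂ) * u y * conj (v y) ∂(volQ M) := by
  rw [L2.inner_def]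
  refine integral_congr_ae ?_
  filter_upwards [coeFn_mulL b.bcf u] with y hy
  rw [hy, RCLike.inner_apply, SmoothPer.bcf_apply]

theorem integrable_mulL (b : SmoothPer M) (u v : L2Q M) :
    Integrable (fun y => (b.toFun y : ℂ) * u y * conj (v y)) (volQ M) := by
  refine (L2.integrable_inner (𝕜 := ℂ) v (mulL M b.bcf u)).congr ?_
  filter_upwards [coeFn_mulL b.bcf u] with y hy
  rw [hy, RCLike.inner_apply, SmoothPer.bcf_apply]

theorem blochForm_eq_inner (b : Fin d → Fin d → SmoothPer M) (δ : ℝ) (η : E d) (u v : HS M) :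
    blochForm Λ (fun y => Matrix.of fun k l => (b k l).toFun y) δ η (ofHS M u) (ofHS M v)
      = inner ℂ v (opA Λ b δ η u) := by
  rw [inner_opA, blochForm]
  congr 1
  · simp only [inner_mulL]
    rw [Finset.sum_congr rfl fun k _ => (integral_finsetSum _ fun l _ =>
        integrable_mulL (b k l) (sgrad Λ l η u) (sgrad Λ k η v)).symm,
      ← integral_finsetSum _ fun k _ => integrable_finsetSum _ fun l _ =>
        integrable_mulL (b k l) (sgrad Λ l η u) (sgrad Λ k η v)]
    refine integral_congr_ae ?_
    have h1 := ae_all_iff.2 fun l => coeFn_sgrad Λ l η u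
    have h2 := ae_all_iff.2 fun l => coeFn_sgrad Λ l η v
    filter_upwards [h1, h2] with y h1 h2
    simp only [h1, h2, Matrix.of_apply]
  · congr 1
    simp only [L2.inner_def, RCLike.inner_apply]
    rw [integral_finsetSum]
    · rfl
    · intro m _
      have := L2.integrable_inner (𝕜 := ℂ) (h1Grad (ofHS M v) m) (h1Grad (ofHS M u) m)
      simpa only [RCLike.inner_apply] using this

end Operator

/-! ### Coercivity and inversion of the operator modified on constants -/

section Elliptic

variable {M d : ℕ} (Λ : Matrix (Fin M) (Fin d) ℝ)

/-- A symmetric nonnegative smooth periodic coefficient matrix. -/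
structure IsNonnegCoeff (b : Fin d → Fin d → SmoothPer M) : Prop where
  symm : ∀ y k l, (b k l).toFun y = (b l k).toFun y
  nonneg : ∀ y (v : Fin d → ℝ), 0 ≤ ∑ k, ∑ l, (b k l).toFun y * v l * v k

variable {b : Fin d → Fin d → SmoothPer M} {δ : ℝ} {η : E d} {lam : ℝ}

theorem IsNonnegCoeff.tr (hb : IsNonnegCoeff b) (m : Fin M) (s : ℝ) :
    IsNonnegCoeff fun k l => (b k l).tr m s :=
  ⟨fun _ k l => hb.symm _ k l, fun _ v => hb.nonneg _ v⟩

/-- The real part of the form at `w` is the real form at `Re w` plus the real form at `Im w`. -/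
theorem IsNonnegCoeff.re_nonneg (hb : IsNonnegCoeff b) (y : E M) (w : Fin d → ℂ) :
    0 ≤ (∑ k, ∑ l, ((b k l).toFun y : ℂ) * w l * conj (w k)).re := by
  have h := add_nonneg (hb.nonneg y fun k => (w k).re) (hb.nonneg y fun k => (w k).im)
  refine h.trans (le_of_eq ?_)
  simp only [Complex.re_sum, ← Finset.sum_add_distrib]
  refine Finset.sum_congr rfl fun k _ => Finset.sum_congr rfl fun l _ => ?_
  simp only [Complex.mul_re, Complex.mul_im, Complex.ofReal_re, Complex.ofReal_im, Complex.conj_re,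
    Complex.conj_im]
  ring

theorem IsNonnegCoeff.re_inner_opA (hb : IsNonnegCoeff b) (δ : ℝ) (η : E d) (u : HS M) :
    δ * ∑ m, ‖grad m u‖ ^ 2 ≤ (inner ℂ u (opA Λ b δ η u)).re := by
  rw [inner_opA]
  have h1 : 0 ≤ (∑ k, ∑ l, inner ℂ (sgrad Λ k η u) (mulL M (b k l).bcf (sgrad Λ l η u))).re := by
    simp only [inner_mulL]
    rw [Finset.sum_congr rfl fun k _ => (integral_finsetSum _ fun l _ =>
        integrable_mulL (b k l) (sgrad Λ l η u) (sgrad Λ k η u)).symm,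
      ← integral_finsetSum _ fun k _ => integrable_finsetSum _ fun l _ =>
        integrable_mulL (b k l) (sgrad Λ l η u) (sgrad Λ k η u)]
    have hint := integrable_finsetSum (μ := volQ M) Finset.univ fun (k : Fin d) _ =>
      integrable_finsetSum Finset.univ fun (l : Fin d) _ =>
        integrable_mulL (b k l) (sgrad Λ l η u) (sgrad Λ k η u)
    refine (integral_nonneg fun y => ?_).trans_eq (integral_re hint)
    exact hb.re_nonneg y fun k => sgrad Λ k η u y
  have h2 : ((δ : ℂ) * ∑ m, inner ℂ (grad m u) (grad m u)).re = δ * ∑ m, ‖grad m u‖ ^ 2 := by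
    rw [Complex.re_ofReal_mul, Complex.re_sum]
    congr 1
    exact Finset.sum_congr rfl fun m _ => inner_self_eq_norm_sq (𝕜 := ℂ) _
  rw [Complex.add_re, h2]
  linarith

theorem inner_mulL_symm (b : SmoothPer M) (u v : L2Q M) :
    inner ℂ v (mulL M b.bcf u) = conj (inner ℂ u (mulL M b.bcf v)) := by
  rw [inner_mulL, inner_mulL, ← integral_conj]
  congr 1
  funext y
  simp only [map_mul, Complex.conj_conj, Complex.conj_ofReal]
  ring

theorem IsNonnegCoeff.mulL_comm (hb : IsNonnegCoeff b) (k l : Fin d) :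
    (b k l).bcf = (b l k).bcf := by
  ext y
  rw [SmoothPer.bcf_apply, SmoothPer.bcf_apply, hb.symm]

theorem IsNonnegCoeff.inner_opA_symm (hb : IsNonnegCoeff b) (δ : ℝ) (η : E d) (u v : HS M) :
    inner ℂ v (opA Λ b δ η u) = inner ℂ (opA Λ b δ η v) u := by
  rw [← inner_conj_symm (opA Λ b δ η v) u, inner_opA, inner_opA, map_add, map_mul,
    Complex.conj_ofReal, map_sum, map_sum, Finset.sum_comm]
  congr 1
  · refine Finset.sum_congr rfl fun l _ => ?_
    rw [map_sum]
    refine Finset.sum_congr rfl fun k _ => ?_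
    rw [inner_mulL_symm, hb.mulL_comm]
  · congr 1
    exact Finset.sum_congr rfl fun m _ => (inner_conj_symm _ _).symm

/-- The Riesz representative of `u ↦ ⟨1, u⟩`. -/
def meanVec (M : ℕ) : HS M := embAdj M (charL 0)

theorem inner_meanVec (u : HS M) : inner ℂ (meanVec M) u = coef (emb M u) 0 := by
  rw [← inner_conj_symm, meanVec, inner_embAdj, inner_conj_symm, coef]

/-- The operator `opA - lam`, modified on the constants so that it becomes coercive. -/
def opP (b : Fin d → Fin d → SmoothPer M) (δ : ℝ) (η : E d) (lam : ℝ) : HS M →L[ℂ] HS M :=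
  opA Λ b δ η - (lam : ℂ) • (embAdj M).comp (emb M)
    + (innerSL ℂ (meanVec M)).smulRight (meanVec M)

theorem opP_apply (b : Fin d → Fin d → SmoothPer M) (δ : ℝ) (η : E d) (lam : ℝ) (u : HS M) :
    opP Λ b δ η lam u = opA Λ b δ η u - (lam : ℂ) • embAdj M (emb M u)
      + coef (emb M u) 0 • meanVec M := by
  simp only [opP, add_apply, sub_apply, smul_apply, ContinuousLinearMap.comp_apply,
    ContinuousLinearMap.smulRight_apply, innerSL_apply_apply, inner_meanVec]

theorem inner_opP (b : Fin d → Fin d → SmoothPer M) (δ : ℝ) (η : E d) (lam : ℝ) (u v : HS M) :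
    inner ℂ v (opP Λ b δ η lam u) = inner ℂ v (opA Λ b δ η u)
      - (lam : ℂ) * inner ℂ (emb M v) (emb M u)
      + coef (emb M u) 0 * conj (coef (emb M v) 0) := by
  rw [opP_apply, inner_add_right, inner_sub_right, inner_smul_right, inner_smul_right,
    inner_embAdj, ← inner_meanVec v, inner_conj_symm]

theorem IsNonnegCoeff.inner_opP_symm (hb : IsNonnegCoeff b) (δ : ℝ) (η : E d) (lam : ℝ)
    (u v : HS M) : inner ℂ v (opP Λ b δ η lam u) = inner ℂ (opP Λ b δ η lam v) u := by
  rw [← inner_conj_symm (opP Λ b δ η lam v) u, inner_opP, inner_opP, map_add, map_sub, map_mul,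
    map_mul, Complex.conj_ofReal, Complex.conj_conj, inner_conj_symm, inner_conj_symm,
    hb.inner_opA_symm]
  ring

/-- Half of the energy `δ‖∇u‖²` is kept. The other half and `|c₀|²`, where `c₀` is the zeroth
coefficient of `u`, absorb `(δ/2)‖u‖²` (in `L²`) by Poincaré, since `δ/2 ≤ 1`. -/
theorem IsNonnegCoeff.le_re_inner_opP (hb : IsNonnegCoeff b) (hδ0 : 0 < δ) (hδ1 : δ < 1)
    (η : E d) (lam : ℝ) (u : HS M) :
    min (δ / 2) (δ / 2 - lam) * ‖u‖ ^ 2 ≤ (inner ℂ u (opP Λ b δ η lam u)).re := by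
  have h1 := hb.re_inner_opA Λ δ η u
  have h2 := poincare u
  have h3 : (inner ℂ (emb M u) (emb M u) : ℂ) = ((‖emb M u‖ ^ 2 : ℝ) : ℂ) := by
    rw [inner_self_eq_norm_sq_to_K]; norm_cast
  have h4 : (inner ℂ u (opP Λ b δ η lam u)).re = (inner ℂ u (opA Λ b δ η u)).re
      - lam * ‖emb M u‖ ^ 2 + ‖coef (emb M u) 0‖ ^ 2 := by
    rw [inner_opP, h3, Complex.mul_conj, Complex.normSq_eq_norm_sq]
    simp only [Complex.add_re, Complex.sub_re, Complex.re_ofReal_mul, Complex.ofReal_re]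
  rw [h4, norm_sq_HS]
  set g := ∑ m, ‖grad m u‖ ^ 2 with hg
  have hg0 : 0 ≤ g := Finset.sum_nonneg fun _ _ => by positivity
  have h5 : min (δ / 2) (δ / 2 - lam) * (‖emb M u‖ ^ 2 + g)
      ≤ (δ / 2 - lam) * ‖emb M u‖ ^ 2 + δ / 2 * g := by
    rw [mul_add]
    gcongr
    · exact min_le_right _ _
    · exact min_le_left _ _
  nlinarith [sq_nonneg ‖coef (emb M u) 0‖]

theorem IsNonnegCoeff.isUnit_opP (hb : IsNonnegCoeff b) (hδ0 : 0 < δ) (hδ1 : δ < 1)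
    (η : E d) (hlam : lam < δ / 2) : IsUnit (opP Λ b δ η lam) := by
  have hc : 0 < min (δ / 2) (δ / 2 - lam) := lt_min (by linarith) (by linarith)
  refine ContinuousLinearMap.isUnit_of_forall_le_norm_inner_map _ (c := ⟨_, hc.le⟩) hc fun u => ?_
  rw [norm_inner_symm, mul_comm]
  exact (hb.le_re_inner_opP Λ hδ0 hδ1 η lam u).trans (Complex.re_le_norm _)

/-- The solution `u` of `opP u = meanVec`. -/
def sol (b : Fin d → Fin d → SmoothPer M) (δ : ℝ) (η : E d) (lam : ℝ) : HS M :=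
  Ring.inverse (opP Λ b δ η lam) (meanVec M)

theorem opP_sol (h : IsUnit (opP Λ b δ η lam)) :
    opP Λ b δ η lam (sol Λ b δ η lam) = meanVec M :=
  congrArg (fun f : HS M →L[ℂ] HS M => f (meanVec M)) (Ring.mul_inverse_cancel _ h)

/-- For an eigenvector the hypothesis holds with `a` its zeroth coefficient, because only the
rank-one term of `opP` survives. So eigenspaces below `δ/2` are at most one-dimensional. -/
theorem eq_smul_sol (h : IsUnit (opP Λ b δ η lam)) {u : HS M} {a : ℂ}
    (hu : opP Λ b δ η lam u = a • meanVec M) : u = a • sol Λ b δ η lam := by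
  rw [sol, ← map_smul, ← hu]
  exact (congrArg (fun f : HS M →L[ℂ] HS M => f u) (Ring.inverse_mul_cancel _ h)).symm

/-- The coefficient equals `⟨opP sol, sol⟩`, real by symmetry. The eigenvalue condition is thus a
single real equation. -/
theorem IsNonnegCoeff.conj_coef_sol (hb : IsNonnegCoeff b) (h : IsUnit (opP Λ b δ η lam)) :
    conj (coef (emb M (sol Λ b δ η lam)) 0) = coef (emb M (sol Λ b δ η lam)) 0 := by
  rw [← inner_meanVec, inner_conj_symm]
  conv_lhs => rw [← opP_sol Λ h]
  rw [hb.inner_opP_symm, opP_sol Λ h]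

theorem contDiff_sgrad (l : Fin d) {n : WithTop ℕ∞} : ContDiff ℝ n (sgrad Λ l) := by
  have : ContDiff ℝ n fun η : E d => Complex.I * (η l : ℂ) :=
    contDiff_const.mul (Complex.ofRealCLM.contDiff.comp (EuclideanSpace.proj (𝕜 := ℝ) l).contDiff)
  exact contDiff_const.add (this.smul contDiff_const)

theorem contDiff_sgradAdj (l : Fin d) {n : WithTop ℕ∞} : ContDiff ℝ n (sgradAdj Λ l) := by
  have : ContDiff ℝ n fun η : E d => Complex.I * (η l : ℂ) :=
    contDiff_const.mul (Complex.ofRealCLM.contDiff.comp (EuclideanSpace.proj (𝕜 := ℝ) l).contDiff)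
  exact contDiff_const.sub (this.smul contDiff_const)

theorem ContDiff.clm_comp_complex {X F G K : Type*} [NormedAddCommGroup X] [NormedSpace ℝ X]
    [NormedAddCommGroup F] [NormedSpace ℂ F] [NormedAddCommGroup G] [NormedSpace ℂ G]
    [NormedAddCommGroup K] [NormedSpace ℂ K] {n : WithTop ℕ∞} {f : X → G →L[ℂ] K}
    {g : X → F →L[ℂ] G} (hf : ContDiff ℝ n f) (hg : ContDiff ℝ n g) :
    ContDiff ℝ n fun x => (f x).comp (g x) :=
  ((ContinuousLinearMap.compL ℂ F G K).bilinearRestrictScalars ℝ).isBoundedBilinearMap.contDiff.comp₂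
    hf hg

theorem contDiff_opP {X : Type*} [NormedAddCommGroup X] [NormedSpace ℝ X] {n : WithTop ℕ∞}
    {β : X → Fin d → Fin d → SmoothPer M} {η : X → E d} {lam : X → ℝ} (δ : ℝ)
    (hβ : ∀ k l, ContDiff ℝ n fun x => (β x k l).bcf) (hη : ContDiff ℝ n η)
    (hlam : ContDiff ℝ n lam) : ContDiff ℝ n fun x => opP Λ (β x) δ (η x) (lam x) := by
  unfold opP opA
  refine ((ContDiff.add (ContDiff.sum fun k _ => ContDiff.sum fun l _ => ?_) contDiff_const).sub
    ((Complex.ofRealCLM.contDiff.comp hlam).smul contDiff_const)).add contDiff_const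
  refine ContDiff.clm_comp_complex ((contDiff_sgradAdj Λ k).comp hη)
    (ContDiff.clm_comp_complex ?_ ((contDiff_sgrad Λ l).comp hη))
  exact ((mulL M).restrictScalars ℝ).contDiff.comp (hβ k l)

/-- Inversion is analytic on units. Used with `n = ω` in `(η, λ)`, and with `n = ∞` when the
coefficients are also translated, since these are only smooth. -/
theorem contDiffAt_sol {X : Type*} [NormedAddCommGroup X] [NormedSpace ℝ X] {n : WithTop ℕ∞}
    {β : X → Fin d → Fin d → SmoothPer M} {η : X → E d} {lam : X → ℝ} (δ : ℝ)
    (hβ : ∀ k l, ContDiff ℝ n fun x => (β x k l).bcf) (hη : ContDiff ℝ n η)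
    (hlam : ContDiff ℝ n lam) {x : X} (hu : IsUnit (opP Λ (β x) δ (η x) (lam x))) :
    ContDiffAt ℝ n (fun x => sol Λ (β x) δ (η x) (lam x)) x := by
  obtain ⟨U, hU⟩ := hu
  have h1 := contDiffAt_ringInverse (n := n) ℝ U
  rw [hU] at h1
  have h2 := h1.comp x (contDiff_opP Λ δ hβ hη hlam).contDiffAt
  exact (((ContinuousLinearMap.apply ℂ (HS M) (meanVec M)).restrictScalars ℝ).contDiff.contDiffAt).comp
    x h2

end Elliptic

/-! ### Regularity in the cell variable -/

section Regularity

variable {M d : ℕ} (Λ : Matrix (Fin M) (Fin d) ℝ) {b : Fin d → Fin d → SmoothPer M} {δ : ℝ}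

theorem coef_smul (a : ℂ) (u : L2Q M) (k : Fin M → ℤ) : coef (a • u) k = a * coef u k :=
  inner_smul_right _ _ _

theorem coef_sub (u v : L2Q M) (k : Fin M → ℤ) : coef (u - v) k = coef u k - coef v k :=
  inner_sub_right _ _ _

theorem norm_coef_le (u : L2Q M) (k : Fin M → ℤ) : ‖coef u k‖ ≤ ‖u‖ := by
  have h := norm_inner_le_norm (𝕜 := ℂ) (charL k) u
  rwa [(orthonormal_charL M).1 k, one_mul] at h

theorem sgrad_transH (l : Fin d) (η : E d) (m : Fin M) (s : ℝ) (u : HS M) :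
    sgrad Λ l η (transH m s u) = transL m s (sgrad Λ l η u) := by
  simp only [sgrad, add_apply, sum_apply, smul_apply, grad_transH, emb_transH, map_add, map_sum,
    map_smul]

theorem mulL_tr_transL (b : SmoothPer M) (m : Fin M) (s : ℝ) (u : L2Q M) :
    mulL M (b.tr m s).bcf (transL m s u) = transL m s (mulL M b.bcf u) := by
  refine Lp.ext ?_
  have h := (measurePreserving_shift m s).quasiMeasurePreserving.ae (coeFn_mulL b.bcf u)
  filter_upwards [coeFn_mulL (b.tr m s).bcf (transL m s u), coeFn_transL m s u,
    coeFn_transL m s (mulL M b.bcf u), h] with y h1 h2 h3 h4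
  rw [h1, h2, h3, h4, SmoothPer.bcf_apply, SmoothPer.bcf_apply, b.periodic.comp_shift]
  rfl

theorem inner_opA_transH (b : Fin d → Fin d → SmoothPer M) (δ : ℝ) (η : E d) (m : Fin M) (s : ℝ)
    (u v : HS M) :
    inner ℂ (transH m s v) (opA Λ (fun k l => (b k l).tr m s) δ η (transH m s u))
      = inner ℂ v (opA Λ b δ η u) := by
  simp only [inner_opA, sgrad_transH, mulL_tr_transL, grad_transH, LinearIsometry.inner_map_map]

theorem transH_eigen {η : E d} {lam : ℝ} {u : HS M}
    (hu : opA Λ b δ η u = (lam : ℂ) • embAdj M (emb M u)) (m : Fin M) (s : ℝ) :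
    opA Λ (fun k l => (b k l).tr m s) δ η (transH m s u)
      = (lam : ℂ) • embAdj M (emb M (transH m s u)) := by
  refine ext_inner_left ℂ fun v => ?_
  -- Every test vector is itself a translate, so the equation can be translated back.
  rw [← transH_neg_transH m s v, inner_opA_transH, hu, inner_smul_right, inner_smul_right,
    inner_embAdj, inner_embAdj, emb_transH m s u, emb_transH m s (transH m (-s) v),
    LinearIsometry.inner_map_map]

/-- The translate solves the translated problem with the same mean, so `eq_smul_sol` identifies it.
The dependence on `s` now sits only in the coefficients, and elliptic regularity becomes smoothness
of operator inversion. -/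
theorem transH_eq_smul_sol (hb : IsNonnegCoeff b) (hδ0 : 0 < δ) (hδ1 : δ < 1) {η : E d} {lam : ℝ}
    (hlam : lam < δ / 2) {u : HS M} (hu : opA Λ b δ η u = (lam : ℂ) • embAdj M (emb M u))
    (m : Fin M) (s : ℝ) : transH m s u
      = coef (emb M u) 0 • sol Λ (fun k l => (b k l).tr m s) δ η lam := by
  refine eq_smul_sol Λ ((hb.tr m s).isUnit_opP Λ hδ0 hδ1 η hlam) ?_
  rw [opP_apply, transH_eigen Λ hu, sub_self, zero_add, emb_transH, coef_transL]
  simp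

/-- The iterates are directional derivatives of the joint map, so they remain jointly smooth and in
particular continuous in the parameter from `X`. -/
theorem exists_iterated_partial {X Y : Type*} [NormedAddCommGroup X] [NormedSpace ℝ X]
    [NormedAddCommGroup Y] [NormedSpace ℝ Y] {F : X × ℝ → Y} {O : Set (X × ℝ)} (hO : IsOpen O)
    (hF : ContDiffOn ℝ ∞ F O) : ∃ W : ℕ → X × ℝ → Y, W 0 = F ∧ (∀ N, ContDiffOn ℝ ∞ (W N) O) ∧
      ∀ N, ∀ p ∈ O, HasDerivAt (fun s => W N (p.1, s)) (W (N + 1) p) p.2 := by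
  let W : ℕ → X × ℝ → Y := fun N =>
    Nat.rec F (fun _ G p => fderiv ℝ G p ((0 : X), (1 : ℝ))) N
  have hW : ∀ N, ContDiffOn ℝ ∞ (W N) O := by
    intro N
    induction N with
    | zero => exact hF
    | succ N ih => exact (ih.fderiv_of_isOpen hO (by simp)).clm_apply contDiffOn_const
  refine ⟨W, rfl, hW, fun N p hp => ?_⟩
  have h1 : HasFDerivAt (W N) (fderiv ℝ (W N) p) (p.1, p.2) :=
    (((hW N).contDiffAt (hO.mem_nhds hp)).differentiableAt (by simp)).hasFDerivAt
  have h2 : HasDerivAt (fun s : ℝ => (p.1, s)) ((0 : X), (1 : ℝ)) p.2 :=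
    (hasDerivAt_const _ _).prodMk (hasDerivAt_id _)
  exact h1.comp_hasDerivAt p.2 h2

/-- The `N`-th `s`-derivative at 0 of `transH_eq_smul_sol`, read mode by mode. `W` does not depend
on the eigenvector and is continuous in `(η, λ)`, which later yields continuity of eigenfunctions in
the sup norm. -/
theorem exists_coef_eq (hb : IsNonnegCoeff b) (hδ0 : 0 < δ) (hδ1 : δ < 1) (m : Fin M) (N : ℕ) :
    ∃ W : E d × ℝ → L2Q M, ContinuousOn W {p | p.2 < δ / 2} ∧
      ∀ (η : E d) (lam : ℝ), lam < δ / 2 → ∀ u : HS M,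
        opA Λ b δ η u = (lam : ℂ) • embAdj M (emb M u) → ∀ k : Fin M → ℤ,
        (Complex.I * (k m : ℂ)) ^ N * coef (emb M u) k
          = coef (emb M u) 0 * coef (W (η, lam)) k := by
  set O : Set ((E d × ℝ) × ℝ) := {p | p.1.2 < δ / 2} with hO
  have hOo : IsOpen O := isOpen_lt (by fun_prop) continuous_const
  set F : (E d × ℝ) × ℝ → L2Q M :=
    fun p => emb M (sol Λ (fun k l => (b k l).tr m p.2) δ p.1.1 p.1.2) with hF
  have hFs : ContDiffOn ℝ ∞ F O := fun p hp => by
    have h1 := contDiffAt_sol (n := ∞) Λ (β := fun (p : (E d × ℝ) × ℝ) k l => (b k l).tr m p.2)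
      (η := fun p => p.1.1) (lam := fun p => p.1.2) δ
      (fun k l => ((b k l).contDiff_bcf m).comp contDiff_snd)
      (contDiff_fst.comp contDiff_fst) (contDiff_snd.comp contDiff_fst) (x := p)
      ((hb.tr m p.2).isUnit_opP Λ hδ0 hδ1 p.1.1 hp)
    exact ((((emb M).restrictScalars ℝ).contDiff.contDiffAt).comp p h1).contDiffWithinAt
  obtain ⟨W, hW0, hWs, hWd⟩ := exists_iterated_partial hOo hFs
  refine ⟨fun p => W N (p, 0), ?_, fun η lam hlam u hu k => ?_⟩
  · exact (hWs N).continuousOn.comp (by fun_prop) fun p hp => hp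
  -- Stated for all `s` so that the induction can differentiate; only `s = 0` is used.
  · have key : ∀ N (s : ℝ), (Complex.I * (k m : ℂ)) ^ N *
        (Complex.exp (Complex.I * (k m : ℂ) * s) * coef (emb M u) k)
        = coef (emb M u) 0 * coef (W N ((η, lam), s)) k := by
      intro N
      induction N with
      | zero =>
        intro s
        have h1 := congrArg (fun v => coef (emb M v) k)
          (transH_eq_smul_sol Λ hb hδ0 hδ1 hlam hu m s)
        simp only [emb_transH, coef_transL, map_smul, coef_smul] at h1
        rw [hW0, pow_zero, one_mul]
        exact h1
      | succ N ih =>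
        intro s
        have h1 : HasDerivAt (fun s : ℝ => (Complex.I * (k m : ℂ)) ^ N *
            (Complex.exp (Complex.I * (k m : ℂ) * s) * coef (emb M u) k))
            ((Complex.I * (k m : ℂ)) ^ N *
            (Complex.exp (Complex.I * (k m : ℂ) * s) * (Complex.I * (k m : ℂ))
              * coef (emb M u) k)) s := by
          have h0 : HasDerivAt (fun s : ℝ => Complex.I * (k m : ℂ) * (s : ℂ))
              (Complex.I * (k m : ℂ)) s := by
            simpa using (Complex.ofRealCLM.hasDerivAt (x := s)).const_mul (Complex.I * (k m : ℂ))
          exact (h0.cexp.mul_const _).const_mul _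
        have h2 : HasDerivAt (fun s : ℝ => coef (emb M u) 0 * coef (W N ((η, lam), s)) k)
            (coef (emb M u) 0 * coef (W (N + 1) ((η, lam), s)) k) s := by
          have h3 := hWd N ((η, lam), s) hlam
          exact ((((innerSL ℂ (charL k)).restrictScalars ℝ).hasFDerivAt).comp_hasDerivAt s
            h3).const_mul _
        simp only [ih] at h1
        rw [← h1.unique h2, pow_succ]
        ring
    have := key N 0
    simpa using this

end Regularity

/-! ### Absolutely convergent Fourier series -/

/-- `∑ |k_m|`. -/
def absSum {M : ℕ} (k : Fin M → ℤ) : ℝ := ∑ m, |(k m : ℝ)|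

theorem absSum_nonneg {M : ℕ} (k : Fin M → ℤ) : 0 ≤ absSum k :=
  Finset.sum_nonneg fun _ _ => abs_nonneg _

theorem summable_prod_inv (M : ℕ) :
    Summable fun k : Fin M → ℤ => ∏ m, (1 + (k m : ℝ) ^ 2)⁻¹ := by
  have h1 : Summable fun n : ℤ => (1 + (n : ℝ) ^ 2)⁻¹ := by
    have h2 : Summable fun n : ℤ => 1 / (n : ℝ) ^ 2 := Real.summable_one_div_int_pow.2 one_lt_two
    refine Summable.of_norm_bounded_eventually h2 ?_
    have h3 : ∀ᶠ n : ℤ in cofinite, n ≠ 0 := by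
      simpa using (Set.finite_singleton (0 : ℤ)).compl_mem_cofinite
    filter_upwards [h3] with n hn
    have hn' : (0 : ℝ) < (n : ℝ) ^ 2 := by positivity
    rw [Real.norm_of_nonneg (by positivity), one_div]
    gcongr
    linarith
  induction M with
  | zero => exact Summable.of_finite
  | succ M ih =>
    rw [← (Fin.consEquiv fun _ : Fin (M + 1) => ℤ).summable_iff]
    have h := h1.mul_of_nonneg ih (fun _ => by positivity)
      (fun _ => Finset.prod_nonneg fun _ _ => by positivity)
    refine h.congr fun p => ?_
    simp [Fin.prod_univ_succ, Fin.consEquiv, mul_comm]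

/-- The exponent `2M` gives one square per coordinate: `(1 + |k|)^{2M} ≥ ∏ (1 + k_m²)`, and the
product of one-dimensional series converges. -/
theorem summable_one_add_absSum (M : ℕ) :
    Summable fun k : Fin M → ℤ => ((1 + absSum k) ^ (2 * M))⁻¹ := by
  refine Summable.of_nonneg_of_le (fun k => ?_) (fun k => ?_) (summable_prod_inv M)
  · have := absSum_nonneg k
    positivity
  · rw [Finset.prod_inv_distrib]
    refine inv_anti₀ (Finset.prod_pos fun _ _ => by positivity) ?_
    have h : ∀ m, 1 + (k m : ℝ) ^ 2 ≤ (1 + absSum k) ^ 2 := by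
      intro m
      have h1 : |(k m : ℝ)| ≤ absSum k :=
        Finset.single_le_sum (f := fun m => |(k m : ℝ)|) (fun _ _ => abs_nonneg _)
          (Finset.mem_univ m)
      have h2 := abs_nonneg (k m : ℝ)
      rw [← sq_abs (k m : ℝ)]
      nlinarith
    calc ∏ m, (1 + (k m : ℝ) ^ 2) ≤ ∏ _m : Fin M, (1 + absSum k) ^ 2 :=
          Finset.prod_le_prod (fun _ _ => by positivity) fun m _ => h m
      _ = (1 + absSum k) ^ (2 * M) := by simp [pow_mul]

theorem exists_one_add_absSum_pow_le (M N : ℕ) : ∃ C : ℝ, 0 ≤ C ∧ ∀ k : Fin M → ℤ,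
    (1 + absSum k) ^ (N + 1) ≤ C * (1 + ∑ m, |(k m : ℝ)| ^ (N + 1)) := by
  refine ⟨2 ^ N * (1 + (M : ℝ) ^ N), by positivity, fun k => ?_⟩
  have h1 := add_pow_le zero_le_one (absSum_nonneg k) (N + 1)
  have h2 : absSum k ^ (N + 1) ≤ (M : ℝ) ^ N * ∑ m, |(k m : ℝ)| ^ (N + 1) := by
    rcases Nat.eq_zero_or_pos M with rfl | hM
    · simp [absSum]
    · have h := pow_sum_div_card_le_sum_pow (s := Finset.univ) (f := fun m => |(k m : ℝ)|)
        (fun _ _ => abs_nonneg _) N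
      rwa [Finset.card_univ, Fintype.card_fin, div_le_iff₀' (by positivity)] at h
  have h3 : 0 ≤ ∑ m, |(k m : ℝ)| ^ (N + 1) := Finset.sum_nonneg fun _ _ => by positivity
  have h4 : (0 : ℝ) ≤ (M : ℝ) ^ N := by positivity
  rw [one_pow, Nat.add_sub_cancel] at h1
  refine h1.trans ?_
  rw [mul_assoc]
  gcongr
  nlinarith

/-! ### Fourier series with summable coefficients as functions -/

section FourierSum

variable {M : ℕ}

/-- The normalized character as a bounded continuous function. -/
def charB (k : Fin M → ℤ) : BoundedContinuousFunction (E M) ℂ :=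
  BoundedContinuousFunction.ofNormedAddCommGroup (fun y => (normC M : ℂ) * char k y)
    ((contDiff_char (n := 0) k).continuous.const_mul _) (normC M) fun y => by
      rw [norm_mul, norm_char, Complex.norm_real, Real.norm_of_nonneg (normC_pos M).le, mul_one]

theorem charB_apply (k : Fin M → ℤ) (y : E M) : charB k y = (normC M : ℂ) * char k y := rfl

theorem norm_charB_le (k : Fin M → ℤ) : ‖charB k‖ ≤ normC M :=
  BoundedContinuousFunction.norm_ofNormedAddCommGroup_le _ (normC_pos M).le _

theorem toLp_charB (k : Fin M → ℤ) :
    BoundedContinuousFunction.toLp 2 (volQ M) ℂ (charB k) = charL k := by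
  refine Lp.ext ?_
  filter_upwards [BoundedContinuousFunction.coeFn_toLp 2 (volQ M) ℂ (charB k), coeFn_charL k]
    with y h1 h2
  rw [h1, h2, charB_apply]

/-- The sum of the Fourier series with coefficients `c`. -/
def fourierSum (c : (Fin M → ℤ) → ℂ) : BoundedContinuousFunction (E M) ℂ := ∑' k, c k • charB k

theorem summable_smul_charB {c : (Fin M → ℤ) → ℂ} (hc : Summable fun k => ‖c k‖) :
    Summable fun k => c k • charB k := by
  refine Summable.of_norm_bounded (hc.mul_right (normC M)) fun k => ?_
  rw [norm_smul]
  gcongr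
  exact norm_charB_le k

theorem toLp_fourierSum {u : L2Q M} (hu : Summable fun k => ‖coef u k‖) :
    BoundedContinuousFunction.toLp 2 (volQ M) ℂ (fourierSum (coef u)) = u := by
  have h1 := (BoundedContinuousFunction.toLp 2 (volQ M) ℂ :
    BoundedContinuousFunction (E M) ℂ →L[ℂ] L2Q M).hasSum (summable_smul_charB hu).hasSum
  have h2 := (charBasis M).hasSum_repr u
  simp only [HilbertBasis.repr_apply_apply, charBasis_apply] at h2
  refine h1.unique ?_
  convert h2 using 1
  funext k
  rw [map_smul, toLp_charB, coef]

theorem fourierSum_apply {c : (Fin M → ℤ) → ℂ} (hc : Summable fun k => ‖c k‖) (y : E M) :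
    fourierSum c y = ∑' k, c k * ((normC M : ℂ) * char k y) :=
  ((BoundedContinuousFunction.evalCLM ℂ y).map_tsum (summable_smul_charB hc))

theorem qPeriodic_fourierSum {c : (Fin M → ℤ) → ℂ} (hc : Summable fun k => ‖c k‖) :
    QPeriodic (fourierSum c) := fun i y => by
  simp only [fourierSum_apply hc, qPeriodic_char _ i y]

theorem norm_fourierSum_sub_le {c c' : (Fin M → ℤ) → ℂ} (hc : Summable fun k => ‖c k‖)
    (hc' : Summable fun k => ‖c' k‖) :
    ‖fourierSum c - fourierSum c'‖ ≤ normC M * ∑' k, ‖c k - c' k‖ := by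
  have hs : Summable fun k => ‖c k - c' k‖ :=
    Summable.of_nonneg_of_le (fun _ => norm_nonneg _) (fun _ => norm_sub_le _ _) (hc.add hc')
  rw [fourierSum, fourierSum, ← (summable_smul_charB hc).tsum_sub (summable_smul_charB hc'),
    ← tsum_mul_left]
  refine tsum_of_norm_bounded (hs.mul_left _).hasSum fun k => ?_
  rw [← sub_smul, norm_smul, mul_comm]
  gcongr
  exact norm_charB_le k

theorem norm_iteratedFDeriv_char_le (k : Fin M → ℤ) (n : ℕ) (y : E M) :
    ‖iteratedFDeriv ℝ n (char k) y‖ ≤ absSum k ^ n := by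
  set L : E M →L[ℝ] ℝ := ∑ j, (k j : ℝ) • EuclideanSpace.proj (𝕜 := ℝ) j with hL
  have hLn : ‖L‖ ≤ absSum k := by
    refine (norm_sum_le _ _).trans (Finset.sum_le_sum fun j _ => ?_)
    rw [norm_smul, Real.norm_eq_abs]
    refine mul_le_of_le_one_right (abs_nonneg _) ?_
    exact ContinuousLinearMap.opNorm_le_bound _ zero_le_one fun v => by
      rw [one_mul]; exact PiLp.norm_apply_le v j
  have h1 : char k = (fun t : ℝ => Complex.exp (t * Complex.I)) ∘ L := by
    funext y
    simp [char, hL]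
  have hg : ContDiff ℝ ∞ fun t : ℝ => Complex.exp (t * Complex.I) :=
    (Complex.ofRealCLM.contDiff.mul contDiff_const).cexp
  have h2 : ∀ (n : ℕ) (t : ℝ), iteratedDeriv n (fun t : ℝ => Complex.exp (t * Complex.I)) t
      = Complex.I ^ n * Complex.exp (t * Complex.I) := by
    intro n
    induction n with
    | zero => simp
    | succ n ih =>
      intro t
      rw [iteratedDeriv_succ, funext ih]
      have h0 : HasDerivAt (fun s : ℝ => (s : ℂ) * Complex.I) Complex.I t := by
        simpa using (Complex.ofRealCLM.hasDerivAt (x := t)).mul_const Complex.I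
      rw [(h0.cexp.const_mul _).deriv, pow_succ]
      ring
  rw [h1, L.iteratedFDeriv_comp_right hg y (mod_cast le_top)]
  refine (ContinuousMultilinearMap.norm_compContinuousLinearMap_le _ _).trans ?_
  rw [norm_iteratedFDeriv_eq_norm_iteratedDeriv, h2, norm_mul, norm_pow, Complex.norm_I, one_pow,
    Complex.norm_exp_ofReal_mul_I, one_mul, one_mul, Finset.prod_const, Finset.card_univ,
    Fintype.card_fin]
  gcongr

theorem contDiff_fourierSum {c : (Fin M → ℤ) → ℂ} (hc0 : Summable fun k => ‖c k‖)
    (hc : ∀ n : ℕ, Summable fun k => ‖c k‖ * absSum k ^ n) : ContDiff ℝ ∞ (fourierSum c) := by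
  have h : (fourierSum c : E M → ℂ) = fun y => ∑' k, c k * ((normC M : ℂ) * char k y) :=
    funext fun y => fourierSum_apply hc0 y
  rw [h]
  have hcd : ∀ k, ContDiff ℝ ∞ fun y => c k * ((normC M : ℂ) * char k y) := fun k =>
    contDiff_const.mul (contDiff_const.mul (contDiff_char k))
  refine contDiff_tsum (v := fun n k => normC M * (‖c k‖ * absSum k ^ n)) hcd
    (fun n _ => (hc n).mul_left _) fun n k y _ => ?_
  have h1 : (fun y => c k * ((normC M : ℂ) * char k y)) = (c k * (normC M : ℂ)) • char k := by
    funext y; simp [mul_assoc]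
  rw [h1, iteratedFDeriv_const_smul_apply (contDiff_char k).contDiffAt, norm_smul, norm_mul,
    Complex.norm_real, Real.norm_of_nonneg (normC_pos M).le, mul_comm ‖c k‖, mul_assoc]
  have := norm_iteratedFDeriv_char_le k n y
  have := (normC_pos M).le
  gcongr

/-- Continuity gives equality on the open cube and on its closure, which contains the range of
`lift`; periodicity does the rest. -/
theorem eq_of_ae_eq_volQ {f g : E M → ℂ} (hf : Continuous f) (hg : Continuous g)
    (hfp : QPeriodic f) (hgp : QPeriodic g) (h : f =ᵐ[volQ M] g) : f = g := by
  set U : Set (E M) := WithLp.ofLp ⁻¹' (Set.univ.pi fun _ : Fin M => Set.Ioo 0 (2 * Real.pi))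
    with hU
  have hUo : IsOpen U :=
    (isOpen_set_pi Set.finite_univ fun _ _ => isOpen_Ioo).preimage (PiLp.continuous_ofLp 2 _)
  have hUQ : U ⊆ cellQ M := fun y hy i => Set.Ioo_subset_Ico_self (hy i trivial)
  have h1 : Set.EqOn f g U := Measure.eqOn_open_of_ae_eq
    (ae_restrict_of_ae_restrict_of_subset hUQ h) hUo hf.continuousOn hg.continuousOn
  have h2 : closure U = WithLp.ofLp ⁻¹' (Set.univ.pi fun _ : Fin M => Set.Icc 0 (2 * Real.pi)) := by
    rw [hU]
    refine ((PiLp.homeomorph 2 (fun _ : Fin M => ℝ)).preimage_closure _).symm.trans ?_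
    rw [closure_pi_set]
    simp only [closure_Ioo Real.two_pi_pos.ne]
    rfl
  have h3 : Set.EqOn f g (closure U) := h1.closure hf hg
  funext y
  rw [← hfp.comp_lift_proj, ← hgp.comp_lift_proj]
  refine h3 ?_
  rw [h2]
  intro i _
  have := (AddCircle.equivIoc (1 : ℝ) 0 (proj y i)).2
  have hp := Real.pi_pos
  refine ⟨?_, ?_⟩
  · have := this.1
    simp only [lift]
    positivity
  · have := this.2
    simp only [lift]
    nlinarith

end FourierSum

/-! ### Decay of Fourier coefficients of eigenfunctions -/

section Decay

variable {M d : ℕ}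

/-- `C` does not depend on the coefficients, so the bound applies both to one eigenfunction and to
differences of two. -/
theorem exists_decay_const (M N : ℕ) : ∃ C : ℝ, 0 ≤ C ∧
    ∀ (c : (Fin M → ℤ) → ℂ) (D : ℝ) (D' : Fin M → ℝ), (∀ k, ‖c k‖ ≤ D) →
      (∀ m k, ‖(Complex.I * (k m : ℂ)) ^ (N + 1) * c k‖ ≤ D' m) →
      ∀ k, (1 + absSum k) ^ (N + 1) * ‖c k‖ ≤ C * (D + ∑ m, D' m) := by
  obtain ⟨C, hC0, hC⟩ := exists_one_add_absSum_pow_le M N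
  refine ⟨C, hC0, fun c D D' hD hD' k => ?_⟩
  have h1 : ∀ m, |(k m : ℝ)| ^ (N + 1) * ‖c k‖ ≤ D' m := fun m => by
    have h := hD' m k
    rwa [norm_mul, norm_pow, norm_mul, Complex.norm_I, one_mul, Complex.norm_intCast] at h
  calc (1 + absSum k) ^ (N + 1) * ‖c k‖
      ≤ C * (1 + ∑ m, |(k m : ℝ)| ^ (N + 1)) * ‖c k‖ := by gcongr; exact hC k
    _ = C * (‖c k‖ + ∑ m, |(k m : ℝ)| ^ (N + 1) * ‖c k‖) := by rw [← Finset.sum_mul]; ring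
    _ ≤ C * (D + ∑ m, D' m) := by
      gcongr with m
      · exact hD k
      · exact h1 m

theorem summable_of_decay {c : (Fin M → ℤ) → ℂ} {n : ℕ} {C : ℝ}
    (h : ∀ k, (1 + absSum k) ^ (2 * M + n) * ‖c k‖ ≤ C) :
    Summable fun k => ‖c k‖ * absSum k ^ n := by
  refine Summable.of_nonneg_of_le (fun k => ?_) (fun k => ?_)
    ((summable_one_add_absSum M).mul_left C)
  · have := absSum_nonneg k
    positivity
  · have h0 := absSum_nonneg k
    have h1 : ‖c k‖ * absSum k ^ n ≤ ‖c k‖ * (1 + absSum k) ^ n := by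
      gcongr
      linarith
    refine h1.trans ?_
    rw [← div_eq_mul_inv, le_div_iff₀ (by positivity)]
    refine le_trans (le_of_eq ?_) (h k)
    rw [pow_add]
    ring

variable (Λ : Matrix (Fin M) (Fin d) ℝ) {b : Fin d → Fin d → SmoothPer M} {δ : ℝ}

theorem exists_decay (hb : IsNonnegCoeff b) (hδ0 : 0 < δ) (hδ1 : δ < 1) {η : E d} {lam : ℝ}
    (hlam : lam < δ / 2) {u : HS M} (hu : opA Λ b δ η u = (lam : ℂ) • embAdj M (emb M u)) (N : ℕ) :
    ∃ C : ℝ, ∀ k, (1 + absSum k) ^ (N + 1) * ‖coef (emb M u) k‖ ≤ C := by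
  choose W _ hW using fun m => exists_coef_eq Λ hb hδ0 hδ1 m (N + 1)
  obtain ⟨C, _, hC⟩ := exists_decay_const M N
  refine ⟨_, hC (coef (emb M u)) ‖emb M u‖
    (fun m => ‖coef (emb M u) 0 • W m (η, lam)‖) (norm_coef_le _) fun m k => ?_⟩
  rw [hW m η lam hlam u hu k, ← coef_smul]
  exact norm_coef_le _ _

theorem summable_coef_mul (hb : IsNonnegCoeff b) (hδ0 : 0 < δ) (hδ1 : δ < 1) {η : E d} {lam : ℝ}
    (hlam : lam < δ / 2) {u : HS M} (hu : opA Λ b δ η u = (lam : ℂ) • embAdj M (emb M u)) (n : ℕ) :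
    Summable fun k => ‖coef (emb M u) k‖ * absSum k ^ n := by
  obtain ⟨C, hC⟩ := exists_decay Λ hb hδ0 hδ1 hlam hu (2 * M + n)
  refine summable_of_decay (C := C) fun k => le_trans ?_ (hC k)
  have := absSum_nonneg k
  exact mul_le_mul_of_nonneg_right (pow_le_pow_right₀ (by linarith) (by omega)) (norm_nonneg _)

theorem summable_coef (hb : IsNonnegCoeff b) (hδ0 : 0 < δ) (hδ1 : δ < 1) {η : E d} {lam : ℝ}
    (hlam : lam < δ / 2) {u : HS M} (hu : opA Λ b δ η u = (lam : ℂ) • embAdj M (emb M u)) :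
    Summable fun k => ‖coef (emb M u) k‖ := by
  simpa using summable_coef_mul Λ hb hδ0 hδ1 hlam hu 0

theorem continuousOn_fourierSum (hb : IsNonnegCoeff b) (hδ0 : 0 < δ) (hδ1 : δ < 1)
    {S : Set (E d)} {lam : E d → ℝ} {u : E d → HS M} (hlc : ContinuousOn lam S)
    (huc : ContinuousOn u S) (hlam : ∀ η ∈ S, lam η < δ / 2)
    (hu : ∀ η ∈ S, opA Λ b δ η (u η) = (lam η : ℂ) • embAdj M (emb M (u η))) :
    ContinuousOn (fun η => fourierSum (coef (emb M (u η)))) S := by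
  intro η₀ hη₀
  -- Order `2M` suffices for summability; `2M + 1` matches the form of `exists_decay_const`, and the
  -- extra power is discarded.
  choose W hWc hW using fun m => exists_coef_eq Λ hb hδ0 hδ1 m (2 * M + 1)
  obtain ⟨C, hC0, hC⟩ := exists_decay_const M (2 * M)
  set V : Fin M → E d → L2Q M := fun m η => coef (emb M (u η)) 0 • W m (η, lam η) with hV
  have hVc : ∀ m, ContinuousOn (V m) S := by
    intro m
    have h1 : ContinuousOn (fun η => coef (emb M (u η)) 0) S :=
      (innerSL ℂ (charL (0 : Fin M → ℤ))).continuous.comp_continuousOn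
        ((emb M).continuous.comp_continuousOn huc)
    have h2 : ContinuousOn (fun η => W m (η, lam η)) S :=
      (hWc m).comp (continuousOn_id.prodMk hlc) fun η hη => hlam η hη
    exact h1.smul h2
  set bd : E d → ℝ := fun η => C * (‖emb M (u η) - emb M (u η₀)‖ + ∑ m, ‖V m η - V m η₀‖) with hbd
  have hbdc : ContinuousOn bd S := by
    refine continuousOn_const.mul (ContinuousOn.add ?_ (continuousOn_finsetSum _ fun m _ => ?_))
    · exact (((emb M).continuous.comp_continuousOn huc).sub continuousOn_const).norm
    · exact ((hVc m).sub continuousOn_const).norm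
  have hbd0 : bd η₀ = 0 := by simp [hbd]
  have hdec : ∀ η ∈ S, ∀ k, ‖coef (emb M (u η)) k - coef (emb M (u η₀)) k‖
      ≤ bd η * ((1 + absSum k) ^ (2 * M))⁻¹ := by
    intro η hη k
    -- The decay bound for the difference has a constant `bd η` tending to 0 as `η → η₀`.
    have h1 := hC (fun k => coef (emb M (u η)) k - coef (emb M (u η₀)) k)
      ‖emb M (u η) - emb M (u η₀)‖ (fun m => ‖V m η - V m η₀‖)
      (fun k => by rw [← coef_sub]; exact norm_coef_le _ _)
      (fun m k => by
        rw [mul_sub, hW m η _ (hlam η hη) _ (hu η hη), hW m η₀ _ (hlam η₀ hη₀) _ (hu η₀ hη₀),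
          ← coef_smul, ← coef_smul, ← coef_sub]
        exact norm_coef_le _ _) k
    have h0 := absSum_nonneg k
    rw [← div_eq_mul_inv, le_div_iff₀ (by positivity), mul_comm]
    exact le_trans (mul_le_mul_of_nonneg_right (pow_le_pow_right₀ (by linarith) (by omega))
      (norm_nonneg _)) h1
  have hsum : ∀ η ∈ S, Summable fun k => ‖coef (emb M (u η)) k‖ := fun η hη =>
    summable_coef Λ hb hδ0 hδ1 (hlam η hη) (hu η hη)
  have hbound : ∀ η ∈ S, ‖fourierSum (coef (emb M (u η))) - fourierSum (coef (emb M (u η₀)))‖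
      ≤ normC M * (bd η * ∑' k : Fin M → ℤ, ((1 + absSum k) ^ (2 * M))⁻¹) := by
    intro η hη
    refine (norm_fourierSum_sub_le (hsum η hη) (hsum η₀ hη₀)).trans ?_
    have := (normC_pos M).le
    gcongr
    rw [← tsum_mul_left]
    refine Summable.tsum_le_tsum (hdec η hη) ?_ ((summable_one_add_absSum M).mul_left _)
    exact Summable.of_nonneg_of_le (fun _ => norm_nonneg _) (hdec η hη)
      ((summable_one_add_absSum M).mul_left _)
  have hlim : Tendsto (fun η => normC M * (bd η * ∑' k : Fin M → ℤ, ((1 + absSum k) ^ (2 * M))⁻¹))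
      (𝓝[S] η₀) (𝓝 0) := by
    have h := (((hbdc η₀ hη₀).tendsto).mul_const
      (∑' k : Fin M → ℤ, ((1 + absSum k) ^ (2 * M))⁻¹)).const_mul (normC M)
    rwa [hbd0, zero_mul, mul_zero] at h
  refine tendsto_iff_norm_sub_tendsto_zero.2 ?_
  refine squeeze_zero' (Eventually.of_forall fun _ => norm_nonneg _) ?_ hlim
  filter_upwards [self_mem_nhdsWithin] with η hη using hbound η hη

end Decay

/-! ### Bloch waves as eigenvectors -/

section Bloch

variable {M d : ℕ} {Λ : Matrix (Fin M) (Fin d) ℝ} {B : E M → Matrix (Fin d) (Fin d) ℝ}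

/-- The entries of `B`. -/
def IsQuasiperiodicCoeff.coeff (hB : IsQuasiperiodicCoeff Λ B) (k l : Fin d) : SmoothPer M where
  toFun y := B y k l
  smooth := hB.smooth k l
  periodic := fun i y => congrFun (congrFun (hB.periodic i y) k) l

theorem IsQuasiperiodicCoeff.isNonnegCoeff (hB : IsQuasiperiodicCoeff Λ B) :
    IsNonnegCoeff hB.coeff :=
  ⟨fun y k l => hB.symm_all y k l, fun y v => hB.nonneg y v⟩

theorem isBlochWave_iff (hB : IsQuasiperiodicCoeff Λ B) (δ : ℝ) (η : E d) (μ : ℝ) (u : HS M) :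
    IsBlochWave Λ B δ η μ (ofHS M u) ↔
      u ≠ 0 ∧ opA Λ hB.coeff δ η u = (μ : ℂ) • embAdj M (emb M u) := by
  have h1 : ∀ v : HS M, blochForm Λ B δ η (ofHS M u) (ofHS M v)
      = inner ℂ v (opA Λ hB.coeff δ η u) := fun v =>
    blochForm_eq_inner Λ hB.coeff δ η u v
  have h2 : ∀ v : HS M, (μ : ℂ) * ∫ y, h1Fn (ofHS M u) y * conj (h1Fn (ofHS M v) y) ∂(volQ M)
      = inner ℂ v ((μ : ℂ) • embAdj M (emb M u)) := fun v => by
    rw [inner_smul_right, inner_embAdj, L2.inner_def]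
    simp only [RCLike.inner_apply]
    rfl
  refine and_congr Iff.rfl ⟨fun h => ext_inner_left ℂ fun v => ?_, fun h v => ?_⟩
  · rw [← h1, ← h2]
    exact h (ofHS M v)
  · have h3 := h1 (show HS M from v)
    have h4 := h2 (show HS M from v)
    rw [h, ← h4] at h3
    exact h3

theorem opA_zero_constH (b : Fin d → Fin d → SmoothPer M) (δ : ℝ) :
    opA Λ b δ 0 (constH M) = 0 := by
  have h : ∀ l, sgrad Λ l 0 (constH M) = 0 := fun l => by
    simp only [sgrad, add_apply, sum_apply, smul_apply, grad_constH, PiLp.zero_apply]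
    simp
  refine ext_inner_left ℂ fun v => ?_
  simp [inner_opA, h, grad_constH]

theorem coef_charL_zero : coef (charL (M := M) 0) 0 = 1 := by
  rw [coef, inner_self_eq_norm_sq_to_K, (orthonormal_charL M).1]
  simp

theorem constH_ne_zero : constH M ≠ 0 := fun h => by
  have h1 := coef_charL_zero (M := M)
  rw [← emb_constH, h, map_zero, coef, inner_zero_right] at h1
  exact zero_ne_one h1

theorem zero_mem_blochEigenvalues (hB : IsQuasiperiodicCoeff Λ B) (δ : ℝ) :
    (0 : ℝ) ∈ blochEigenvalues Λ B δ 0 :=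
  ⟨ofHS M (constH M), (isBlochWave_iff hB δ 0 0 (constH M)).2
    ⟨constH_ne_zero, by rw [opA_zero_constH]; simp⟩⟩

/-- Near `η = 0` a ground state branch is continuous in `η`, uniformly in `y`. -/
theorem IsGroundState.exists_continuousOn (hB : IsQuasiperiodicCoeff Λ B) {δ : ℝ} (hδ0 : 0 < δ)
    (hδ1 : δ < 1) {θ : ℝ} {lam : E d → ℝ} {Φ : E d → H1 M} {φ : E d → E M → ℂ}
    (h : IsGroundState Λ B δ θ lam Φ φ) :
    ∃ r, 0 < r ∧ r ≤ θ ∧ ∃ Ψ : E d → BoundedContinuousFunction (E M) ℂ,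
      ContinuousOn Ψ (Metric.ball 0 r) ∧ ∀ η ∈ Metric.ball 0 r, ∀ y, φ η y = Ψ η y := by
  have h0 : (0 : E d) ∈ Metric.ball (0 : E d) θ := Metric.mem_ball_self h.radius_pos
  -- Constants make 0 an eigenvalue at `η = 0`, so minimality forces `lam 0 ≤ 0`. By continuity
  -- `lam` stays in the range where `opP` is invertible.
  have hlam0 : lam 0 < δ / 2 :=
    ((h.isLeast 0 h0).2 (zero_mem_blochEigenvalues hB δ)).trans_lt (by linarith)
  have hev : ∀ᶠ η in 𝓝 (0 : E d), lam η < δ / 2 :=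
    (h.analytic_eigenvalue 0 h0).continuousAt.eventually_lt continuousAt_const hlam0
  obtain ⟨r, hr0, hr⟩ := Metric.eventually_nhds_iff_ball.1 hev
  have hsub : Metric.ball (0 : E d) (min r θ) ⊆ Metric.ball 0 θ :=
    Metric.ball_subset_ball (min_le_right _ _)
  set u : E d → HS M := Φ with hu
  have hlam : ∀ η ∈ Metric.ball (0 : E d) (min r θ), lam η < δ / 2 := fun η hη =>
    hr η (Metric.ball_subset_ball (min_le_left _ _) hη)
  have heig : ∀ η ∈ Metric.ball (0 : E d) (min r θ),
      opA Λ hB.coeff δ η (u η) = (lam η : ℂ) • embAdj M (emb M (u η)) := fun η hη =>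
    ((isBlochWave_iff hB δ η (lam η) (u η)).1 (h.isBlochWave η (hsub hη))).2
  refine ⟨min r θ, lt_min hr0 h.radius_pos, min_le_right _ _,
    fun η => fourierSum (coef (emb M (u η))), ?_, fun η hη y => ?_⟩
  · refine continuousOn_fourierSum Λ hB.isNonnegCoeff hδ0 hδ1
      (h.analytic_eigenvalue.continuousOn.mono hsub) ?_ hlam heig
    exact h.analytic_eigenfunction.continuousOn.mono hsub
  · have hs := summable_coef Λ hB.isNonnegCoeff hδ0 hδ1 (hlam η hη) (heig η hη)
    -- The given smooth representative and the Fourier series agree a.e., hence everywhere.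
    refine congr_fun (eq_of_ae_eq_volQ (h.smooth η (hsub hη)).continuous
      (fourierSum (coef (emb M (u η)))).continuous (h.periodic η (hsub hη))
      (qPeriodic_fourierSum hs) ?_) y
    have h1 := BoundedContinuousFunction.coeFn_toLp 2 (volQ M) ℂ (fourierSum (coef (emb M (u η))))
    rw [toLp_fourierSum hs] at h1
    exact (h.represents η (hsub hη)).symm.trans h1

end Bloch

/-! ### Existence of a ground state branch -/

section Existence

variable {M d : ℕ} {Λ : Matrix (Fin M) (Fin d) ℝ} {B : E M → Matrix (Fin d) (Fin d) ℝ} {δ : ℝ}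

/-- At `η = 0` constants are annihilated by `opA`, so `opP` sends `constH` to `(1 - lam) • meanVec`.
-/
theorem sol_zero {b : Fin d → Fin d → SmoothPer M} (hb : IsNonnegCoeff b) (hδ0 : 0 < δ)
    (hδ1 : δ < 1) {lam : ℝ} (hlam : lam < δ / 2) :
    sol Λ b δ 0 lam = ((1 - lam)⁻¹ : ℂ) • constH M := by
  have h1 : (1 - lam : ℂ) ≠ 0 := by
    have : (1 - lam : ℝ) ≠ 0 := by linarith
    exact_mod_cast this
  have h2 : constH M = (1 - lam : ℂ) • sol Λ b δ 0 lam := by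
    refine eq_smul_sol Λ (hb.isUnit_opP Λ hδ0 hδ1 0 hlam) ?_
    rw [opP_apply, opA_zero_constH, emb_constH, coef_charL_zero, sub_smul, one_smul, zero_sub,
      meanVec]
    abel
  rw [h2, smul_smul, inv_mul_cancel₀ h1, one_smul]

/-- The analytic branch of eigenvalues near `0`. -/
theorem exists_analytic_eigenvalue {b : Fin d → Fin d → SmoothPer M} (hb : IsNonnegCoeff b)
    (hδ0 : 0 < δ) (hδ1 : δ < 1) :
    ∃ lam : E d → ℝ, ContDiffAt ℝ ω lam 0 ∧ lam 0 = 0 ∧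
      ∀ᶠ η in 𝓝 0, coef (emb M (sol Λ b δ η (lam η))) 0 = 1 := by
  -- The real part loses nothing, by `conj_coef_sol`. The implicit function follows the level `F (0,
  -- 0) = 1`, which is the eigenvalue condition.
  set F : E d × ℝ → ℝ := fun p => (coef (emb M (sol Λ b δ p.1 p.2)) 0).re with hF
  have hu : IsUnit (opP Λ b δ (0 : E d) 0) := hb.isUnit_opP Λ hδ0 hδ1 0 (by linarith)
  have hFs : ContDiffAt ℝ ω F (0, 0) := by
    have h1 := contDiffAt_sol (n := ω) Λ (β := fun _ : E d × ℝ => b) (η := Prod.fst)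
      (lam := Prod.snd) δ (fun _ _ => contDiff_const) contDiff_fst contDiff_snd (x := (0, 0)) hu
    have h2 := ((Complex.reCLM.comp ((innerSL ℂ (charL (0 : Fin M → ℤ))).restrictScalars ℝ)).comp
      ((emb M).restrictScalars ℝ)).contDiff (n := ω)
    exact h2.contDiffAt.comp _ h1
  have hF0 : ∀ lam : ℝ, lam < δ / 2 → F (0, lam) = (1 - lam)⁻¹ := by
    intro lam hlam
    simp only [hF]
    rw [sol_zero hb hδ0 hδ1 hlam, map_smul, emb_constH, coef_smul, coef_charL_zero, mul_one]
    norm_cast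
  have hd : HasDerivAt (fun lam => F (0, lam)) 1 0 := by
    have h1 : HasDerivAt (fun lam : ℝ => (1 - lam)⁻¹) 1 0 := by
      have h2 := ((hasDerivAt_id (0 : ℝ)).const_sub 1).fun_inv (by simp)
      simpa using h2
    refine h1.congr_of_eventuallyEq ?_
    filter_upwards [eventually_lt_nhds (show (0 : ℝ) < δ / 2 by linarith)] with lam hlam
    exact hF0 lam hlam
  have hfd : fderiv ℝ F (0, 0) ∘L .inr ℝ (E d) ℝ = ContinuousLinearMap.id ℝ ℝ := by
    ext
    have h1 := (hFs.differentiableAt (by simp)).hasFDerivAt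
    have h2 : HasDerivAt (fun s : ℝ => ((0 : E d), s)) ((0 : E d), (1 : ℝ)) 0 :=
      (hasDerivAt_const _ _).prodMk (hasDerivAt_id _)
    have h3 := h1.comp_hasDerivAt (0 : ℝ) h2
    simpa using h3.unique hd
  have hinv : (fderiv ℝ F (0, 0) ∘L .inr ℝ (E d) ℝ).IsInvertible := by
    rw [hfd]
    exact ⟨ContinuousLinearEquiv.refl ℝ ℝ, rfl⟩
  have hω : (ω : WithTop ℕ∞) ≠ 0 := by simp
  have hψ0 := hFs.implicitFunction_apply_self hω hinv
  have hψs := hFs.contDiffAt_implicitFunction hω hinv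
  have hψe := hFs.eventually_apply_implicitFunction hω hinv
  set ψ := hFs.implicitFunction hω hinv
  refine ⟨ψ, hψs, hψ0, ?_⟩
  have hlt : ∀ᶠ η in 𝓝 (0 : E d), ψ η < δ / 2 :=
    hψs.continuousAt.eventually_lt continuousAt_const (by
      rw [show ψ 0 = 0 from hψ0]; linarith)
  filter_upwards [hψe, hlt] with η h1 h2
  rw [hF0 0 (by linarith), sub_zero, inv_one] at h1
  have h3 := Complex.conj_eq_iff_im.1
    (hb.conj_coef_sol Λ (hb.isUnit_opP Λ hδ0 hδ1 η h2))
  exact Complex.ext h1 h3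

theorem sol_eigen {b : Fin d → Fin d → SmoothPer M} (hb : IsNonnegCoeff b)
    (hδ0 : 0 < δ) (hδ1 : δ < 1) {η : E d} {lam : ℝ} (hlam : lam < δ / 2)
    (h : coef (emb M (sol Λ b δ η lam)) 0 = 1) :
    opA Λ b δ η (sol Λ b δ η lam) = (lam : ℂ) • embAdj M (emb M (sol Λ b δ η lam)) := by
  have h1 := opP_sol Λ (hb.isUnit_opP Λ hδ0 hδ1 η hlam)
  rw [opP_apply, h, one_smul, add_eq_right, sub_eq_zero] at h1
  exact h1

/-- An eigenvalue with an eigenvector close to the constants is the least one. -/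
theorem le_of_eigen {b : Fin d → Fin d → SmoothPer M} (hb : IsNonnegCoeff b) (hδ0 : 0 < δ)
    {η : E d} {lam μ : ℝ} (hlam : lam < δ / 2) {u w : HS M}
    (hu : opA Λ b δ η u = (lam : ℂ) • embAdj M (emb M u))
    (hclose : ‖charL 0 - emb M u‖ ^ 2 ≤ 1 / 2) (hw0 : w ≠ 0)
    (hw : opA Λ b δ η w = (μ : ℂ) • embAdj M (emb M w)) : lam ≤ μ := by
  -- Distinct eigenvalues make `w` orthogonal to `u` in `L²`; as `u` is near the normalized
  -- constant, at most half of `‖w‖²` can sit in the mean.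
  by_contra! hlt
  have h1 := hb.inner_opA_symm Λ δ η w u
  rw [hw, hu, inner_smul_right, inner_smul_left, inner_embAdj, Complex.conj_ofReal,
    ← inner_conj_symm (embAdj M (emb M u)) w, inner_embAdj, inner_conj_symm, ← sub_eq_zero,
    ← sub_mul] at h1
  have h2 : inner ℂ (emb M u) (emb M w) = 0 := by
    refine (mul_eq_zero.1 h1).resolve_left ?_
    rw [← Complex.ofReal_sub]
    exact_mod_cast (sub_neg.2 hlt).ne
  have h3 : coef (emb M w) 0 = inner ℂ (charL 0 - emb M u) (emb M w) := by
    rw [inner_sub_left, h2, sub_zero, coef]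
  have h4 : ‖coef (emb M w) 0‖ ^ 2 ≤ 1 / 2 * ‖emb M w‖ ^ 2 := by
    rw [h3]
    calc _ ≤ (‖charL 0 - emb M u‖ * ‖emb M w‖) ^ 2 := by gcongr; exact norm_inner_le_norm _ _
      _ = ‖charL 0 - emb M u‖ ^ 2 * ‖emb M w‖ ^ 2 := by ring
      _ ≤ _ := by gcongr
  have h5 := hb.re_inner_opA Λ δ η w
  have h6 : (inner ℂ w (opA Λ b δ η w)).re = μ * ‖emb M w‖ ^ 2 := by
    rw [hw, inner_smul_right, inner_embAdj, Complex.re_ofReal_mul]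
    congr 1
    exact inner_self_eq_norm_sq (𝕜 := ℂ) _
  rw [h6] at h5
  have h7 := poincare w
  have h8 := norm_sq_HS w
  have h9 : 0 < ‖w‖ ^ 2 := by
    have := norm_pos_iff.2 hw0
    positivity
  set g := ∑ m, ‖grad m w‖ ^ 2
  have hg : 0 ≤ g := Finset.sum_nonneg fun _ _ => by positivity
  have h10 : 0 < ‖emb M w‖ ^ 2 := by
    by_contra! h11
    have h12 : ‖emb M w‖ ^ 2 = 0 := le_antisymm h11 (by positivity)
    rw [h12, mul_zero] at h5
    have : g ≤ 0 := by
      by_contra! h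
      exact (mul_pos hδ0 h).not_ge h5
    linarith
  -- Poincaré leaves `g ≥ ‖emb M w‖² / 2`, so the energy bound forces `μ ≥ δ/2`, against `μ < lam <
  -- δ/2`.
  nlinarith

theorem ball_half_subset_dualCell (d : ℕ) : Metric.ball (0 : E d) (1 / 2) ⊆ dualCell d := by
  intro η hη j
  rw [mem_ball_zero_iff] at hη
  have h := abs_lt.1 ((PiLp.norm_apply_le η j).trans_lt hη)
  exact ⟨by linarith [h.1], h.2⟩

theorem exists_isGroundState (hB : IsQuasiperiodicCoeff Λ B) (hδ0 : 0 < δ) (hδ1 : δ < 1) :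
    ∃ θ lam Φ φ, IsGroundState Λ B δ θ lam Φ φ := by
  have hb := hB.isNonnegCoeff
  obtain ⟨lam, hls, hl0, hl1⟩ := exists_analytic_eigenvalue (Λ := Λ) hb hδ0 hδ1
  set b := hB.coeff
  set u : E d → HS M := fun η => sol Λ b δ η (lam η) with hu
  have hla := hls.analyticAt
  have hus : AnalyticAt ℝ u 0 := by
    have h1 := contDiffAt_sol (n := ω) Λ (β := fun _ : E d × ℝ => b) (η := Prod.fst)
      (lam := Prod.snd) δ (fun _ _ => contDiff_const) contDiff_fst contDiff_snd (x := (0, lam 0))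
      (hb.isUnit_opP Λ hδ0 hδ1 0 (by rw [hl0]; linarith))
    exact (h1.comp (0 : E d) (contDiffAt_id.prodMk hls)).analyticAt
  have hu0 : u 0 = constH M := by
    simp only [hu, hl0]
    rw [sol_zero hb hδ0 hδ1 (by linarith)]
    simp
  have hlt : ∀ᶠ η in 𝓝 (0 : E d), lam η < δ / 2 :=
    hls.continuousAt.eventually_lt continuousAt_const (by rw [hl0]; linarith)
  have hcl : ∀ᶠ η in 𝓝 (0 : E d), ‖charL 0 - emb M (u η)‖ ^ 2 < 1 / 2 := by
    refine ContinuousAt.eventually_lt ?_ continuousAt_const ?_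
    · exact (continuousAt_const.sub ((emb M).continuous.continuousAt.comp hus.continuousAt)).norm.pow 2
    · rw [hu0, emb_constH, sub_self]; simp
  obtain ⟨θ, hθ0, hθ⟩ := Metric.eventually_nhds_iff_ball.1
    ((((hla.eventually_analyticAt.and hus.eventually_analyticAt).and hlt).and hcl).and
      (hl1.and (Metric.ball_mem_nhds (0 : E d) (show (0 : ℝ) < 1 / 2 by norm_num))))
  have heig : ∀ η ∈ Metric.ball (0 : E d) θ,
      opA Λ b δ η (u η) = (lam η : ℂ) • embAdj M (emb M (u η)) := fun η hη =>
    sol_eigen hb hδ0 hδ1 (hθ η hη).1.1.2 (hθ η hη).2.1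
  -- `u 0` is the constant `(2π)^{-M/2}`, of unit norm in `L²(Q)`; `κ` rescales it to the required
  -- `(2π)^{-d/2}`.
  set κ : ℂ := (((2 * Real.pi) ^ (-(d : ℝ) / 2) / normC M : ℝ) : ℂ) with hκ
  have hκ0 : κ ≠ 0 := by
    have : (2 * Real.pi) ^ (-(d : ℝ) / 2) / normC M ≠ 0 :=
      (div_pos (Real.rpow_pos_of_pos (by positivity) _) (normC_pos M)).ne'
    rw [hκ]
    exact Complex.ofReal_ne_zero.2 this
  set U : E d → HS M := fun η => κ • u η with hU
  have hUeig : ∀ η ∈ Metric.ball (0 : E d) θ,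
      opA Λ b δ η (U η) = (lam η : ℂ) • embAdj M (emb M (U η)) := fun η hη => by
    simp only [hU, map_smul, heig η hη]
    rw [smul_comm]
  have hu_ne : ∀ η ∈ Metric.ball (0 : E d) θ, u η ≠ 0 := fun η hη h => by
    have h1 := (hθ η hη).2.1
    change coef (emb M (u η)) 0 = 1 at h1
    rw [h, map_zero, coef, inner_zero_right] at h1
    exact zero_ne_one h1
  have hwave : ∀ η ∈ Metric.ball (0 : E d) θ, IsBlochWave Λ B δ η (lam η) (ofHS M (U η)) :=
    fun η hη => (isBlochWave_iff hB δ η (lam η) (U η)).2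
      ⟨smul_ne_zero hκ0 (hu_ne η hη), hUeig η hη⟩
  have hsum : ∀ η ∈ Metric.ball (0 : E d) θ, Summable fun k => ‖coef (emb M (U η)) k‖ :=
    fun η hη => summable_coef Λ hb hδ0 hδ1 (hθ η hη).1.1.2 (hUeig η hη)
  have hUan : AnalyticOnNhd ℝ U (Metric.ball 0 θ) := fun η hη => by
    exact (((ContinuousLinearMap.lsmul ℂ ℂ κ : HS M →L[ℂ] HS M).restrictScalars ℝ).analyticAt _).comp
      (hθ η hη).1.1.1.2
  refine ⟨θ, lam, fun η => ofHS M (U η), fun η => fourierSum (coef (emb M (U η))),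
    hθ0, fun η hη => ball_half_subset_dualCell d (hθ η hη).2.2, fun η hη => ⟨⟨_, hwave η hη⟩, ?_⟩,
    fun η hη => (hθ η hη).1.1.1.1, hwave, hUan, fun η hη => ?_, fun η hη =>
    qPeriodic_fourierSum (hsum η hη), fun η hη => ?_, fun y => ?_⟩
  · rintro μ ⟨w, hw⟩
    obtain ⟨hw0, hw1⟩ := (isBlochWave_iff hB δ η μ (show HS M from w)).1 hw
    exact le_of_eigen hb hδ0 (hθ η hη).1.1.2 (heig η hη) (hθ η hη).1.2.le hw0 hw1
  · exact contDiff_fourierSum (hsum η hη)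
      (summable_coef_mul Λ hb hδ0 hδ1 (hθ η hη).1.1.2 (hUeig η hη))
  · have h1 := BoundedContinuousFunction.coeFn_toLp 2 (volQ M) ℂ
      (fourierSum (coef (emb M (U η))))
    rw [toLp_fourierSum (hsum η hη)] at h1
    exact h1
  · rw [fourierSum_apply (hsum 0 (Metric.mem_ball_self hθ0)), tsum_eq_single 0]
    · simp only [hU, hu0, map_smul, emb_constH, coef_smul, coef_charL_zero, char_zero, hκ]
      rw [mul_one, mul_one, ← Complex.ofReal_mul, div_mul_cancel₀ _ (normC_pos M).ne']
    · intro k hk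
      simp only [hU, hu0, map_smul, emb_constH, coef_smul]
      rw [coef, (orthonormal_charL M).2 hk]
      simp

end Existence

/-! ### Convergence of the first Bloch coefficient -/

section Convergence

variable {d : ℕ}

theorem norm_exp_neg_I_inner (x ξ : E d) :
    ‖Complex.exp (-Complex.I * (inner ℝ x ξ : ℝ))‖ = 1 := by
  have : -Complex.I * ((inner ℝ x ξ : ℝ) : ℂ) = ((-(inner ℝ x ξ : ℝ) : ℝ) : ℂ) * Complex.I := by
    push_cast; ring
  rw [this, Complex.norm_exp_ofReal_mul_I]

theorem TendstoWeakL2.exists_bound {g : ℕ → Lp ℂ 2 (volume : Measure (E d))}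
    {g₀ : Lp ℂ 2 (volume : Measure (E d))} (h : TendstoWeakL2 g g₀) : ∃ C, ∀ n, ‖g n‖ ≤ C := by
  have h1 : ∀ x, ∃ C, ∀ n, ‖innerSL ℂ (g n) x‖ ≤ C := fun x => by
    obtain ⟨C, hC⟩ := (h x).norm.bddAbove_range
    refine ⟨C, fun n => ?_⟩
    rw [innerSL_apply_apply, norm_inner_symm]
    exact hC ⟨n, rfl⟩
  obtain ⟨C, hC⟩ := banach_steinhaus h1
  exact ⟨C, fun n => by simpa using hC n⟩

/-- Test the weak convergence against `g₀` restricted to the complement of `K`. -/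
theorem TendstoWeakL2.ae_eq_zero {g : ℕ → Lp ℂ 2 (volume : Measure (E d))}
    {g₀ : Lp ℂ 2 (volume : Measure (E d))} (h : TendstoWeakL2 g g₀) {K : Set (E d)}
    (hK : MeasurableSet K) (hg : ∀ n, ∀ᵐ x, x ∉ K → g n x = 0) : ∀ᵐ x, x ∉ K → g₀ x = 0 := by
  have hm := (Lp.memLp g₀).indicator hK.compl
  have h1 : ∀ n, inner ℂ (hm.toLp _) (g n) = 0 := fun n => by
    rw [L2.inner_def]
    refine integral_eq_zero_of_ae ?_
    filter_upwards [hm.coeFn_toLp, hg n] with x h1 h2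
    rw [h1, RCLike.inner_apply, Pi.zero_apply]
    by_cases hx : x ∈ K
    · simp [hx]
    · simp [h2 hx]
  have h2 : inner ℂ (hm.toLp _) g₀ = 0 := by
    have := h (hm.toLp _)
    simp only [h1] at this
    exact tendsto_nhds_unique this tendsto_const_nhds
  have h3 : inner ℂ (hm.toLp _) (hm.toLp _) = 0 := by
    rw [← h2, L2.inner_def, L2.inner_def]
    refine integral_congr_ae ?_
    filter_upwards [hm.coeFn_toLp] with x h1
    rw [h1, RCLike.inner_apply, RCLike.inner_apply]
    by_cases hx : x ∈ K <;> simp [hx]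
  have h4 := Lp.eq_zero_iff_ae_eq_zero.1 (inner_self_eq_zero.1 h3)
  filter_upwards [h4, hm.coeFn_toLp] with x h5 h6 hx
  rw [h5] at h6
  simpa [hx] using h6.symm

/-- Pointwise `t ≤ 1 + t²` on `K`: a crude bound, but uniform along an `L²`-bounded sequence. -/
theorem integrable_of_ae_eq_zero {K : Set (E d)} (hK : IsCompact K)
    (f : Lp ℂ 2 (volume : Measure (E d))) (hf : ∀ᵐ x, x ∉ K → f x = 0) :
    Integrable f ∧ ∫ x, ‖f x‖ ≤ volume.real K + ‖f‖ ^ 2 := by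
  have hfin : IsFiniteMeasure (volume.restrict K) := ⟨by
    rw [Measure.restrict_apply_univ]; exact hK.measure_lt_top⟩
  have h1 : IntegrableOn f K := ((Lp.memLp f).restrict K).integrable one_le_two
  have h2 : Integrable f := h1.integrable_of_ae_notMem_eq_zero hf
  have h3 : Integrable (fun x => ‖f x‖ ^ 2) :=
    (memLp_two_iff_integrable_sq_norm (Lp.aestronglyMeasurable f)).1 (Lp.memLp f)
  have h4 : ∫ x, ‖f x‖ ^ 2 = ‖f‖ ^ 2 := by
    have h5 : inner ℂ f f = ((‖f‖ ^ 2 : ℝ) : ℂ) := by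
      rw [inner_self_eq_norm_sq_to_K]; norm_cast
    rw [L2.inner_def] at h5
    have h6 : ∀ x, inner ℂ (f x) (f x) = ((‖f x‖ ^ 2 : ℝ) : ℂ) := fun x => by
      rw [inner_self_eq_norm_sq_to_K]; norm_cast
    simp only [h6, integral_complex_ofReal] at h5
    exact_mod_cast h5
  refine ⟨h2, ?_⟩
  have h7 : Integrable (K.indicator fun _ : E d => (1 : ℝ)) :=
    (integrable_indicator_iff hK.measurableSet).2 (integrableOn_const hK.measure_lt_top.ne)
  calc ∫ x, ‖f x‖ ≤ ∫ x, (K.indicator (fun _ => (1 : ℝ)) x + ‖f x‖ ^ 2) := by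
        refine integral_mono_ae h2.norm (h7.add h3) ?_
        filter_upwards [hf] with x hx
        by_cases hxK : x ∈ K
        · simp only [Set.indicator_of_mem hxK]
          nlinarith [sq_nonneg (‖f x‖ - 1), norm_nonneg (f x)]
        · simp [hxK, hx hxK]
    _ = volume.real K + ‖f‖ ^ 2 := by
        rw [integral_add h7 h3, h4, integral_indicator hK.measurableSet]
        simp

theorem continuous_fourierHat {g : E d → ℂ} (hg : Integrable g) : Continuous (fourierHat g) := by
  refine continuous_const.mul (continuous_of_dominated (bound := fun x => ‖g x‖)
    (fun ξ => ?_) (fun ξ => Eventually.of_forall fun x => ?_) hg.norm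
    (Eventually.of_forall fun x => ?_))
  · refine hg.aestronglyMeasurable.mul (Continuous.aestronglyMeasurable ?_)
    fun_prop
  · rw [norm_mul, norm_exp_neg_I_inner, mul_one]
  · fun_prop

/-- For fixed `ξ` the exponential cut off to `K` is an admissible `L²` test function. It is
conjugated because `inner` is conjugate-linear in its first slot. -/
theorem TendstoWeakL2.tendsto_fourierHat {g : ℕ → Lp ℂ 2 (volume : Measure (E d))}
    {g₀ : Lp ℂ 2 (volume : Measure (E d))} (h : TendstoWeakL2 g g₀) {K : Set (E d)}
    (hK : IsCompact K) (hg : ∀ n, ∀ᵐ x, x ∉ K → g n x = 0) (ξ : E d) :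
    Tendsto (fun n => fourierHat (g n) ξ) atTop (𝓝 (fourierHat g₀ ξ)) := by
  have hg₀ := h.ae_eq_zero hK.measurableSet hg
  set χ : E d → ℂ := fun x => conj (Complex.exp (-Complex.I * (inner ℝ x ξ : ℝ))) with hχ
  have hχc : Continuous χ := by
    have : Continuous fun x : E d => Complex.exp (-Complex.I * (inner ℝ x ξ : ℝ)) := by fun_prop
    exact this.star
  have hm : MemLp (K.indicator χ) 2 := by
    refine (memLp_indicator_iff_restrict hK.measurableSet).2 ?_
    have hfin : IsFiniteMeasure (volume.restrict K) := ⟨by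
      rw [Measure.restrict_apply_univ]; exact hK.measure_lt_top⟩
    refine MemLp.of_bound hχc.aestronglyMeasurable 1 (Eventually.of_forall fun x => ?_)
    rw [hχ, RCLike.norm_conj, norm_exp_neg_I_inner]
  have key : ∀ f : Lp ℂ 2 (volume : Measure (E d)), (∀ᵐ x, x ∉ K → f x = 0) →
      inner ℂ (hm.toLp _) f = ∫ x, f x * Complex.exp (-Complex.I * (inner ℝ x ξ : ℝ)) := by
    intro f hf
    rw [L2.inner_def]
    refine integral_congr_ae ?_
    filter_upwards [hm.coeFn_toLp, hf] with x h1 h2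
    rw [h1, RCLike.inner_apply]
    by_cases hx : x ∈ K
    · simp only [Set.indicator_of_mem hx, hχ, Complex.conj_conj]
    · simp [hx, h2 hx]
  have h1 := (h (hm.toLp _)).const_mul (((2 * Real.pi) ^ (-(d : ℝ) / 2) : ℝ) : ℂ)
  simp only [key _ (hg _), key _ hg₀] at h1
  exact h1

/-! ### Bloch coefficients with a bounded continuous amplitude -/

section Coefficient

variable {M : ℕ} (Λ : Matrix (Fin M) (Fin d) ℝ) {φ : E d → E M → ℂ}
  {Ψ : E d → BoundedContinuousFunction (E M) ℂ} {r : ℝ}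

theorem aestronglyMeasurable_blochIntegrand {g : E d → ℂ} (hg : Integrable g)
    (ψ : BoundedContinuousFunction (E M) ℂ) (ε : ℝ) (ξ : E d) :
    AEStronglyMeasurable (fun x => g x * Complex.exp (-Complex.I * (inner ℝ x ξ : ℝ))
      * conj (ψ (ε⁻¹ • wind Λ x))) := by
  have h1 : Continuous fun x : E d => ψ (ε⁻¹ • wind Λ x) :=
    ψ.continuous.comp (Continuous.fun_const_smul (continuous_wind Λ) _)
  refine (hg.aestronglyMeasurable.mul (Continuous.aestronglyMeasurable ?_)).mul
    h1.star.aestronglyMeasurable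
  fun_prop

theorem norm_blochIntegrand_le (g : E d → ℂ) (ψ : BoundedContinuousFunction (E M) ℂ) (ε : ℝ)
    (x ξ : E d) : ‖g x * Complex.exp (-Complex.I * (inner ℝ x ξ : ℝ))
      * conj (ψ (ε⁻¹ • wind Λ x))‖ ≤ ‖ψ‖ * ‖g x‖ := by
  rw [norm_mul, norm_mul, norm_exp_neg_I_inner, mul_one, RCLike.norm_conj, mul_comm]
  gcongr
  exact ψ.norm_coe_le_norm _

theorem integrable_blochIntegrand {g : E d → ℂ} (hg : Integrable g)
    (ψ : BoundedContinuousFunction (E M) ℂ) (ε : ℝ) (ξ : E d) :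
    Integrable (fun x => g x * Complex.exp (-Complex.I * (inner ℝ x ξ : ℝ))
      * conj (ψ (ε⁻¹ • wind Λ x))) :=
  (hg.norm.const_mul ‖ψ‖).mono' (aestronglyMeasurable_blochIntegrand Λ hg ψ ε ξ)
    (Eventually.of_forall fun x => norm_blochIntegrand_le Λ g ψ ε x ξ)

theorem norm_blochCoeff_le {g : E d → ℂ} (hg : Integrable g) {ε : ℝ} {ξ : E d}
    (hφ : ∀ y, φ (ε • ξ) y = Ψ (ε • ξ) y) :
    ‖blochCoeff Λ φ ε g ξ‖ ≤ ‖Ψ (ε • ξ)‖ * ∫ x, ‖g x‖ := by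
  simp only [blochCoeff, hφ]
  rw [← integral_const_mul]
  exact norm_integral_le_of_norm_le (hg.norm.const_mul _)
    (Eventually.of_forall fun x => norm_blochIntegrand_le Λ g _ ε x ξ)

/-- The constant amplitude at `η = 0` produces exactly the unitary Fourier transform, so the error
is governed by the sup norm of the change of amplitude, however fast the argument `Λx/ε` oscillates.
-/
theorem norm_blochCoeff_sub_fourierHat_le {g : E d → ℂ} (hg : Integrable g) {ε : ℝ} {ξ : E d}
    (hφ : ∀ y, φ (ε • ξ) y = Ψ (ε • ξ) y)
    (h0 : ∀ y, Ψ 0 y = (((2 * Real.pi) ^ (-(d : ℝ) / 2) : ℝ) : ℂ)) :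
    ‖blochCoeff Λ φ ε g ξ - fourierHat g ξ‖ ≤ ‖Ψ (ε • ξ) - Ψ 0‖ * ∫ x, ‖g x‖ := by
  have h1 : fourierHat g ξ = ∫ x, g x * Complex.exp (-Complex.I * (inner ℝ x ξ : ℝ))
      * conj (Ψ 0 (ε⁻¹ • wind Λ x)) := by
    simp only [h0, Complex.conj_ofReal]
    rw [integral_mul_const, fourierHat, mul_comm]
  have h2 : blochCoeff Λ φ ε g ξ - fourierHat g ξ
      = ∫ x, g x * Complex.exp (-Complex.I * (inner ℝ x ξ : ℝ))
        * conj ((Ψ (ε • ξ) - Ψ 0) (ε⁻¹ • wind Λ x)) := by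
    rw [h1]
    simp only [blochCoeff, hφ]
    rw [← integral_sub (integrable_blochIntegrand Λ hg _ ε ξ) (integrable_blochIntegrand Λ hg _ ε ξ)]
    simp only [BoundedContinuousFunction.sub_apply, map_sub, mul_sub]
  rw [h2, ← integral_const_mul]
  exact norm_integral_le_of_norm_le (hg.norm.const_mul _)
    (Eventually.of_forall fun x => norm_blochIntegrand_le Λ g _ ε x ξ)

theorem continuousOn_blochCoeff {g : E d → ℂ} (hg : Integrable g) {ε C : ℝ}
    (hΨ : ContinuousOn Ψ (Metric.ball 0 r)) (hC : ∀ η ∈ Metric.ball 0 r, ‖Ψ η‖ ≤ C)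
    (hφ : ∀ η ∈ Metric.ball 0 r, ∀ y, φ η y = Ψ η y) :
    ContinuousOn (blochCoeff Λ φ ε g) {ξ | ε • ξ ∈ Metric.ball 0 r} := by
  have h1 : ContinuousOn (fun ξ => ∫ x, g x * Complex.exp (-Complex.I * (inner ℝ x ξ : ℝ))
      * conj (Ψ (ε • ξ) (ε⁻¹ • wind Λ x))) {ξ | ε • ξ ∈ Metric.ball 0 r} := by
    refine continuousOn_of_dominated (bound := fun x => C * ‖g x‖)
      (fun ξ _ => aestronglyMeasurable_blochIntegrand Λ hg _ ε ξ)
      (fun ξ hξ => Eventually.of_forall fun x => ?_) (hg.norm.const_mul C)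
      (Eventually.of_forall fun x => ?_)
    · refine (norm_blochIntegrand_le Λ g _ ε x ξ).trans ?_
      gcongr
      exact hC _ hξ
    · have h2 : ContinuousOn (fun ξ => Ψ (ε • ξ)) {ξ | ε • ξ ∈ Metric.ball 0 r} :=
        hΨ.comp (by fun_prop) fun ξ hξ => hξ
      have h3 := (BoundedContinuousFunction.evalCLM ℂ
        (ε⁻¹ • wind Λ x) : BoundedContinuousFunction (E M) ℂ →L[ℂ] ℂ).continuous.comp_continuousOn h2
      refine ContinuousOn.mul (Continuous.continuousOn (by fun_prop)) h3.star
  refine h1.congr fun ξ hξ => ?_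
  simp only [blochCoeff, hφ _ hξ]

end Coefficient

theorem tendstoWeakL2Loc_blochCoeff {M : ℕ} (Λ : Matrix (Fin M) (Fin d) ℝ) {φ : E d → E M → ℂ}
    {Ψ : E d → BoundedContinuousFunction (E M) ℂ} {r θ : ℝ} (hr : 0 < r) (hrθ : r ≤ θ)
    (hΨ : ContinuousOn Ψ (Metric.ball 0 r)) (hφ : ∀ η ∈ Metric.ball 0 r, ∀ y, φ η y = Ψ η y)
    (h0 : ∀ y, φ 0 y = (((2 * Real.pi) ^ (-(d : ℝ) / 2) : ℝ) : ℂ))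
    {K : Set (E d)} (hK : IsCompact K) {ε : ℕ → ℝ} (hε0 : Tendsto ε atTop (𝓝 0))
    {g : ℕ → Lp ℂ 2 (volume : Measure (E d))} {g₀ : Lp ℂ 2 (volume : Measure (E d))}
    (hg : ∀ n, ∀ᵐ x, x ∉ K → g n x = 0) (hw : TendstoWeakL2 g g₀) :
    TendstoWeakL2Loc (fun n => Set.indicator {ξ : E d | ε n • ξ ∈ Metric.ball 0 θ}
      (blochCoeff Λ φ (ε n) (g n))) (fourierHat g₀) := by
  have hΨ0 : ∀ y, Ψ 0 y = (((2 * Real.pi) ^ (-(d : ℝ) / 2) : ℝ) : ℂ) := fun y => by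
    rw [← hφ 0 (Metric.mem_ball_self hr), h0]
  have hΨc : ContinuousAt Ψ 0 := hΨ.continuousAt (Metric.ball_mem_nhds _ hr)
  -- Continuity on the open ball of radius `r` gives no bound there; a smaller ball does.
  obtain ⟨ρ, hρ0, hρ⟩ := Metric.eventually_nhds_iff_ball.1
    ((hΨc.norm.eventually_lt continuousAt_const (lt_add_one ‖Ψ 0‖)).and (Metric.ball_mem_nhds 0 hr))
  have hρr : Metric.ball (0 : E d) ρ ⊆ Metric.ball 0 r := fun η hη => (hρ η hη).2
  have hρθ : Metric.ball (0 : E d) ρ ⊆ Metric.ball 0 θ :=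
    hρr.trans (Metric.ball_subset_ball hrθ)
  have hΨρ := hΨ.mono hρr
  have hφρ : ∀ η ∈ Metric.ball (0 : E d) ρ, ∀ y, φ η y = Ψ η y := fun η hη => hφ η (hρr hη)
  have hCρ : ∀ η ∈ Metric.ball (0 : E d) ρ, ‖Ψ η‖ ≤ ‖Ψ 0‖ + 1 := fun η hη => (hρ η hη).1.le
  obtain ⟨C, hC⟩ := hw.exists_bound
  have hgi : ∀ n, Integrable (g n) := fun n => (integrable_of_ae_eq_zero hK (g n) (hg n)).1
  have hgi₀ : Integrable g₀ :=
    (integrable_of_ae_eq_zero hK g₀ (hw.ae_eq_zero hK.measurableSet hg)).1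
  set D : ℝ := volume.real K + C ^ 2 with hD
  have hgD : ∀ n, ∫ x, ‖g n x‖ ≤ D := fun n => by
    refine (integrable_of_ae_eq_zero hK (g n) (hg n)).2.trans ?_
    linarith [pow_le_pow_left₀ (norm_nonneg _) (hC n) 2]
  have hD0 : 0 ≤ D := (integral_nonneg fun _ => norm_nonneg _).trans (hgD 0)
  intro K₂ hK₂
  have hfin : IsFiniteMeasure (volume.restrict K₂) := ⟨by
    rw [Measure.restrict_apply_univ]; exact hK₂.measure_lt_top⟩
  obtain ⟨R, hR⟩ := hK₂.isBounded.exists_norm_le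
  -- `K₂` is bounded and `ε n → 0`, so the cutoff to `ε⁻¹ U` is eventually invisible on `K₂`.
  have hsub : ∀ᶠ n in atTop, ∀ ξ ∈ K₂, ε n • ξ ∈ Metric.ball (0 : E d) ρ := by
    have h1 : Tendsto (fun n => ‖ε n‖ * R) atTop (𝓝 0) := by
      simpa using hε0.norm.mul_const R
    filter_upwards [h1.eventually_lt_const hρ0] with n hn ξ hξ
    rw [mem_ball_zero_iff, norm_smul]
    exact (mul_le_mul_of_nonneg_left (hR ξ hξ) (norm_nonneg _)).trans_lt hn
  have hind : ∀ᶠ n in atTop, ∀ ξ ∈ K₂, Set.indicator {ξ : E d | ε n • ξ ∈ Metric.ball 0 θ}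
      (blochCoeff Λ φ (ε n) (g n)) ξ = blochCoeff Λ φ (ε n) (g n) ξ := by
    filter_upwards [hsub] with n hn ξ hξ
    have hmem : ξ ∈ {ξ : E d | ε n • ξ ∈ Metric.ball 0 θ} :=
      Set.mem_ofPred_eq ▸ hρθ (hn ξ hξ)
    rw [Set.indicator_of_mem hmem]
  have hbd : ∀ᶠ n in atTop, ∀ ξ ∈ K₂, ‖blochCoeff Λ φ (ε n) (g n) ξ‖ ≤ (‖Ψ 0‖ + 1) * D := by
    filter_upwards [hsub] with n hn ξ hξ
    refine (norm_blochCoeff_le Λ (hgi n) (hφρ _ (hn ξ hξ))).trans ?_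
    have := hCρ _ (hn ξ hξ)
    have := hgD n
    gcongr
  have hmeas : ∀ᶠ n in atTop, AEStronglyMeasurable (Set.indicator
      {ξ : E d | ε n • ξ ∈ Metric.ball 0 θ} (blochCoeff Λ φ (ε n) (g n)))
      (volume.restrict K₂) := by
    filter_upwards [hsub, hind] with n hn hi
    have h1 := (continuousOn_blochCoeff Λ (hgi n) (ε := ε n) hΨρ hCρ hφρ).mono
      (show K₂ ⊆ {ξ | ε n • ξ ∈ Metric.ball 0 ρ} from fun ξ hξ => hn ξ hξ)
    refine (h1.aestronglyMeasurable hK₂.measurableSet).congr ?_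
    filter_upwards [ae_restrict_mem hK₂.measurableSet] with ξ hξ using (hi ξ hξ).symm
  have hpt : ∀ ξ ∈ K₂, Tendsto (fun n => Set.indicator {ξ : E d | ε n • ξ ∈ Metric.ball 0 θ}
      (blochCoeff Λ φ (ε n) (g n)) ξ) atTop (𝓝 (fourierHat g₀ ξ)) := by
    intro ξ hξ
    have h1 : Tendsto (fun n => ‖Ψ (ε n • ξ) - Ψ 0‖ * D) atTop (𝓝 0) := by
      have h2 : Tendsto (fun n => ε n • ξ) atTop (𝓝 0) := by
        simpa using hε0.smul_const ξ
      have h3 := ((tendsto_iff_norm_sub_tendsto_zero.1 (hΨc.tendsto.comp h2))).mul_const D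
      simpa using h3
    have h4 : Tendsto (fun n => blochCoeff Λ φ (ε n) (g n) ξ - fourierHat (g n) ξ) atTop (𝓝 0) := by
      refine squeeze_zero_norm' ?_ h1
      filter_upwards [hsub] with n hn
      refine (norm_blochCoeff_sub_fourierHat_le Λ (hgi n) (hφρ _ (hn ξ hξ)) hΨ0).trans ?_
      have := hgD n
      gcongr
    have h5 := h4.add (hw.tendsto_fourierHat hK hg ξ)
    rw [zero_add] at h5
    refine h5.congr' ?_
    filter_upwards [hind] with n hi
    rw [hi ξ hξ, sub_add_cancel]
  have hcont := continuous_fourierHat hgi₀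
  obtain ⟨C₀, hC₀⟩ := hK₂.exists_bound_of_continuousOn hcont.continuousOn
  refine ⟨?_, ?_, fun ψ hψ => ?_⟩
  · exact MemLp.of_bound hcont.aestronglyMeasurable C₀
      ((ae_restrict_mem hK₂.measurableSet).mono fun ξ hξ => hC₀ ξ hξ)
  · filter_upwards [hmeas, hind, hbd] with n h1 h2 h3
    refine MemLp.of_bound h1 ((‖Ψ 0‖ + 1) * D) ((ae_restrict_mem hK₂.measurableSet).mono fun ξ hξ => ?_)
    rw [h2 ξ hξ]
    exact h3 ξ hξ
  · have hψs : AEStronglyMeasurable (fun ξ => conj (ψ ξ)) (volume.restrict K₂) :=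
      hψ.aestronglyMeasurable.star
    -- The majorant is a constant times `‖ψ‖`, integrable because `ψ ∈ L²(K₂)` and `K₂` has finite
    -- measure.
    refine tendsto_integral_filter_of_dominated_convergence
      (fun ξ => (‖Ψ 0‖ + 1) * D * ‖ψ ξ‖) ?_ ?_ ((hψ.integrable one_le_two).norm.const_mul _) ?_
    · filter_upwards [hmeas] with n h1 using h1.mul hψs
    · filter_upwards [hind, hbd] with n h2 h3
      refine (ae_restrict_mem hK₂.measurableSet).mono fun ξ hξ => ?_
      rw [norm_mul, RCLike.norm_conj, h2 ξ hξ]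
      gcongr
      exact h3 ξ hξ
    · exact (ae_restrict_mem hK₂.measurableSet).mono fun ξ hξ => (hpt ξ hξ).mul_const _

end Convergence

end

end QuasiBloch

theorem mainTheorem6 {M d : ℕ} (hMd : d < M) (Λ : Matrix (Fin M) (Fin d) ℝ)
    (B : QuasiBloch.E M → Matrix (Fin d) (Fin d) ℝ)
    (hB : QuasiBloch.IsQuasiperiodicCoeff Λ B) (δ : ℝ) (hδ0 : 0 < δ) (hδ1 : δ < 1) :
    (∃ θ lam Φ φ, QuasiBloch.IsGroundState Λ B δ θ lam Φ φ) ∧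
    ∀ θ lam Φ φ, QuasiBloch.IsGroundState Λ B δ θ lam Φ φ →
      ∀ K : Set (QuasiBloch.E d), IsCompact K →
      ∀ ε : ℕ → ℝ, (∀ n, 0 < ε n) → Tendsto ε atTop (𝓝 0) →
      ∀ (g : ℕ → Lp ℂ 2 (volume : Measure (QuasiBloch.E d)))
        (g₀ : Lp ℂ 2 (volume : Measure (QuasiBloch.E d))),
      (∀ n, ∀ᵐ x, x ∉ K → g n x = 0) →
      QuasiBloch.TendstoWeakL2 g g₀ →
      QuasiBloch.TendstoWeakL2Loc
        (fun n => Set.indicator {ξ : QuasiBloch.E d | ε n • ξ ∈ Metric.ball 0 θ}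
          (QuasiBloch.blochCoeff Λ φ (ε n) (g n)))
        (QuasiBloch.fourierHat g₀) := by
  refine ⟨QuasiBloch.exists_isGroundState hB hδ0 hδ1, ?_⟩
  intro θ lam Φ φ h K hK ε _ hε0 g g₀ hg hw
  obtain ⟨r, hr0, hrθ, Ψ, hΨ, hφ⟩ := h.exists_continuousOn hB hδ0 hδ1
  exact QuasiBloch.tendstoWeakL2Loc_blochCoeff Λ hr0 hrθ hΨ hφ h.normalized hK hε0 hg hw
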